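/- **Setting.** Let $H$ be a locally compact second countable group with identity $e$, and let $d$ be a left-invariant metric on $H$ whose balls $B_d(h,\rho)=\{h'\in H: d(h,h')<\rho\}$ are Borel sets. Suppose that $H$ acts jointly measurably by measure-preserving maps on a probability space $(X,\mu)$, and write $\mu(f)=\int_X f\,d\mu$ and $h\cdot f=f\circ h^{-1}$. Let $\mathcal A$ be an $H$-invariant (not necessarily unital) subalgebra of the real algebra $L^\infty(X,\mu)$, and let $(N_s)_{s\ge 1}$ be a family of semi-norms on $\mathcal A$, indexed by the positive integers, such that for every $s\ge 1$ there are constants $C_s$ and $\sigma_s>0$ with, for all $f,f_1,f_2\in\mathcal A$ and $h\in H$, $$N_s(f)\le C_s N_{s+1}(f),\qquad \|f\|_{L^\infty}\le C_s N_s(f),$$ $$N_s(h\cdot f)\le C_s e^{\sigma_s d(h,e)}N_s(f),\qquad N_s(f_1f_2)\le C_s N_{s+1}(f_1)N_{s+1}(f_2).$$ Suppose that the action is exponentially mixing of all orders with respect to $d$ and $(\mathcal A,(N_s))$: for every integer $r\ge 2$ there are $\delta_r>0$ and an integer $s_r>0$ such that for every integer $s>s_r$ there is a constant $C_{r,s}$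 with $$\Big|\mu\Big(\prod_{i=1}^r h_i\cdot f_i\Big)-\prod_{i=1}^r\mu(f_i)\Big|\le C_{r,s}\,e^{-\delta_r\min_{i\ne j}d(h_i,h_j)}\prod_{i=1}^r N_s(f_i)$$ for all $f_1,\dots,f_r\in\mathcal A$ and $h_1,\dots,h_r\in H$. **Theorem (General CLT).** Let $(\nu_T)_{T\in\mathbb N}$ be a sequence of positive finite Borel measures on $H$, with total masses $\|\nu_T\|=\nu_T(H)$, such that $\|\nu_T\|\to\infty$ and, for every integer $r\ge 3$ and every real $c>0$, $$\lim_{T\to\infty}\int_H \nu_T\big(B_d(h,c\log\|\nu_T\|)\big)^{r-1}\,d\nu_T(h)=0.$$ Let $f\in\mathcal A$ with $\mu(f)=0$, put $(\nu_T*f)(x)=\int_H f(h^{-1}x)\,d\nu_T(h)$, and suppose that the limit $$\sigma_f^2:=\lim_{T\to\infty}\|\nu_T*f\|_{L^2}^2$$ exists and is finite, where $\sigma_f\ge 0$. Then, as $T\to\infty$, $\nu_T*f$ (as a random variable on $(X,\mu)$) converges in distribution to $N(0,\sigma_f^2)$, which for $\sigma_f=0$ is the point mass at $0$. -/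

import Mathlib

open MeasureTheory ProbabilityTheory Filter Topology
open scoped ENNReal NNReal

/-- A left-invariant metric `d` on a group `H` carrying a `σ`-algebra, with measurable balls (so
that the measure of a ball makes sense). The metric is a free-standing function: it is not required
to induce the topology of `H`. A metric that does induce it has open, hence Borel, balls. -/
structure IsLeftInvariantMetric {H : Type*} [Group H] [MeasurableSpace H] (d : H → H → ℝ) :
    Prop where
  eq_zero_iff : ∀ x y, d x y = 0 ↔ x = y
  symm : ∀ x y, d x y = d y x
  triangle : ∀ x y z, d x z ≤ d x y + d y z
  left_invariant : ∀ g x y, d (g * x) (g * y) = d x y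
  measurableSet_ball : ∀ x r, MeasurableSet {y | d x y < r}

/-- The open `d`-ball `B_d(x, r)`. -/
def metricBall {H : Type*} (d : H → H → ℝ) (x : H) (r : ℝ) : Set H := {y | d x y < r}

/-- `d_r(h₁, …, h_r) = min_{i ≠ j} d(h_i, h_j)`; for `r ≥ 2` and a nonnegative `d` this is an
infimum over a finite nonempty set, that is, a minimum. -/
noncomputable def minSeparation {H : Type*} (d : H → H → ℝ) {r : ℕ} (h : Fin r → H) : ℝ :=
  ⨅ p : {p : Fin r × Fin r // p.1 ≠ p.2}, d (h p.1.1) (h p.1.2)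

/-- The pointwise product of two elements of the real space `L^∞(X, μ)`. -/
noncomputable def LInfty.mul {X : Type*} [MeasurableSpace X] {μ : Measure X}
    (f g : Lp ℝ ∞ μ) : Lp ℝ ∞ μ :=
  ((Lp.memLp g).mul (Lp.memLp f) : MemLp (⇑f * ⇑g) ∞ μ).toLp (⇑f * ⇑g)

/-- The translate `h · f = f ∘ h⁻¹` of `f ∈ L^∞(X, μ)` under a measure-preserving action. -/
noncomputable def LInfty.translate {H X : Type*} [Group H] [MeasurableSpace H] [MeasurableSpace X]
    [MulAction H X] [MeasurableSMul₂ H X] {μ : Measure X} [SMulInvariantMeasure H X μ]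
    (h : H) (f : Lp ℝ ∞ μ) : Lp ℝ ∞ μ :=
  Lp.compMeasurePreserving (fun x : X => h⁻¹ • x) (measurePreserving_smul h⁻¹ μ) f

/-- An `H`-invariant sub-algebra of the real algebra `L^∞(X, μ)`. It need not contain the
constants (a typical example consists of smooth functions with compact support). -/
structure InvariantSubalgebra (H : Type*) {X : Type*} [Group H] [MeasurableSpace H]
    [MeasurableSpace X] [MulAction H X] [MeasurableSMul₂ H X] (μ : Measure X)
    [SMulInvariantMeasure H X μ] extends Submodule ℝ (Lp ℝ ∞ μ) where
  mul_mem : ∀ f ∈ carrier, ∀ g ∈ carrier, LInfty.mul f g ∈ carrier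
  translate_mem : ∀ (h : H), ∀ f ∈ carrier, LInfty.translate h f ∈ carrier

namespace InvariantSubalgebra

variable {H X : Type*} [Group H] [MeasurableSpace H] [MeasurableSpace X] [MulAction H X]
  [MeasurableSMul₂ H X] {μ : Measure X} [SMulInvariantMeasure H X μ]

/-- The product of two elements of the sub-algebra. -/
noncomputable def mul (A : InvariantSubalgebra H μ) (f g : A.toSubmodule) : A.toSubmodule :=
  ⟨LInfty.mul f.1 g.1, A.mul_mem f.1 f.2 g.1 g.2⟩

/-- The translate `h · f` of an element of the sub-algebra. -/
noncomputable def translate (A : InvariantSubalgebra H μ) (h : H) (f : A.toSubmodule) :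
    A.toSubmodule :=
  ⟨LInfty.translate h f.1, A.translate_mem h f.1 f.2⟩

/-- The standing conditions on a family of semi-norms `N_s`, indexed by the integers `s ≥ 1`, on
the sub-algebra (the value at the index `0` plays no role): monotonicity, Sobolev embedding,
`H`-boundedness and almost multiplicativity. All constants depend on `s` only. -/
structure IsAdmissible (A : InvariantSubalgebra H μ) (d : H → H → ℝ)
    (N : ℕ → Seminorm ℝ A.toSubmodule) : Prop where
  mono : ∀ s : ℕ, 1 ≤ s → ∃ C : ℝ, ∀ f, N s f ≤ C * N (s + 1) f
  sobolev : ∀ s : ℕ, 1 ≤ s → ∃ C : ℝ, ∀ f : A.toSubmodule, ‖(f : Lp ℝ ∞ μ)‖ ≤ C * N s f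
  bounded : ∀ s : ℕ, 1 ≤ s → ∃ σ : ℝ, 0 < σ ∧ ∃ C : ℝ, ∀ (f : A.toSubmodule) (h : H),
    N s (A.translate h f) ≤ C * Real.exp (σ * d h 1) * N s f
  almost_mul : ∀ s : ℕ, 1 ≤ s → ∃ C : ℝ, ∀ f g : A.toSubmodule,
    N s (A.mul f g) ≤ C * (N (s + 1) f * N (s + 1) g)

/-- The action is exponentially mixing of order `r` with respect to `d` and `(A, (N_s))`. -/
def ExpMixing (A : InvariantSubalgebra H μ) (d : H → H → ℝ)
    (N : ℕ → Seminorm ℝ A.toSubmodule) (r : ℕ) : Prop :=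
  ∃ δ : ℝ, 0 < δ ∧ ∃ s₀ : ℕ, 0 < s₀ ∧ ∀ s : ℕ, s₀ < s → ∃ C : ℝ,
    ∀ (f : Fin r → A.toSubmodule) (h : Fin r → H),
      |(∫ x, ∏ i, (A.translate (h i) (f i) : Lp ℝ ∞ μ) x ∂μ)
          - ∏ i, ∫ x, (f i : Lp ℝ ∞ μ) x ∂μ|
        ≤ C * Real.exp (-δ * minSeparation d h) * ∏ i, N s (f i)

/-- The action is exponentially mixing of all orders. -/
def ExpMixingAllOrders (A : InvariantSubalgebra H μ) (d : H → H → ℝ)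
    (N : ℕ → Seminorm ℝ A.toSubmodule) : Prop :=
  ∀ r : ℕ, 2 ≤ r → A.ExpMixing d N r

end InvariantSubalgebra

/-- The function `(ν * f)(x) = ∫ f(h⁻¹ x) dν(h)`, for a finite measure `ν` on `H` and
`f ∈ L^∞(X, μ)`. The integrand is `ν`-essentially bounded for `μ`-almost every `x`, and up to
`μ`-null sets the function does not depend on the representative of `f`. -/
noncomputable def averageBy {H X : Type*} [Group H] [MeasurableSpace H] [MeasurableSpace X]
    [MulAction H X] {μ : Measure X} (ν : Measure H) (f : Lp ℝ ∞ μ) (x : X) : ℝ :=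
  ∫ h, f (h⁻¹ • x) ∂ν

/-! The proof is by the method of cumulants. Let `m` be the mass of `ν`, let `p` be `ν / m`, and let
`g` be a bounded measurable representative of `f`. The cumulant of order `n + 1` of `ν * g` equals
`m ^ (n + 1)` times the integral, over `n + 1` independent points with law `p`, of the joint
cumulant of the translates of `g` by these points (`integral_rootedCumulant`). Joint cumulants are
defined by a recursion rooted at one index, so no set partitions occur. Integrating this recursion
termwise gives the scalar moment-cumulant recursion.

A joint cumulant is small when the mixed moments nearly factor across a splitting of its indices
(`exists_abs_rootedCumulant_le_of_split`). Multi-scale clustering (`exists_separated_clusters`)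
shows that a configuration either lies within `R * log m` of its root, or breaks into clusters whose
gaps dominate their diameters. In the second case the product over each cluster is a translate of
one element of the algebra with controlled norm. Mixing of order the number of clusters then makes
the joint cumulant smaller than any prescribed power of `m`. The tight configurations contribute at
most a constant times the integral that the hypothesis on `ν` sends to zero.

Hence all cumulants of order at least three tend to 0. The first vanishes and the second tends to `σ
^ 2`. The moments therefore converge to Gaussian moments, and Taylor expansion of characteristic
functions turns this into convergence in distribution. -/

/-! ### Joint cumulants computed from mixed moments. -/

section RootedCumulant

variable {ι : Type*} [DecidableEq ι]

/-- The joint cumulant of the family indexed by `insert a S`, computed from the mixed moments `m`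
by the moment-cumulant recursion in which the block of `a` is singled out. -/
noncomputable def rootedCumulant (m : Finset ι → ℝ) (a : ι) (S : Finset ι) : ℝ :=
  m (insert a S) - ∑ J ∈ S.ssubsets.attach, rootedCumulant m a J.1 * m (S \ J.1)
termination_by S.card
decreasing_by exact Finset.card_lt_card (Finset.mem_ssubsets.1 J.2)

lemma rootedCumulant_eq (m : Finset ι → ℝ) (a : ι) (S : Finset ι) :
    rootedCumulant m a S
      = m (insert a S) - ∑ J ∈ S.ssubsets, rootedCumulant m a J * m (S \ J) := by
  rw [rootedCumulant]
  congr 1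
  exact Finset.sum_attach S.ssubsets (fun J => rootedCumulant m a J * m (S \ J))

/-- Since `m ∅ = 1`, the term `J = S` is the cumulant itself, so the recursion inverts to an
expansion of moments in cumulants. -/
lemma sum_powerset_rootedCumulant {m : Finset ι → ℝ} (h0 : m ∅ = 1) (a : ι) (S : Finset ι) :
    ∑ J ∈ S.powerset, rootedCumulant m a J * m (S \ J) = m (insert a S) := by
  rw [← Finset.insert_erase (Finset.mem_powerset_self S), Finset.sum_insert (by simp)]
  have := rootedCumulant_eq m a S
  rw [Finset.ssubsets] at this
  rw [this, sdiff_self, Finset.bot_eq_empty, h0]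
  ring

lemma exists_abs_rootedCumulant_le (B : ℝ) (hB : 0 ≤ B) (n : ℕ) :
    ∃ C : ℝ, 0 ≤ C ∧ ∀ (m : Finset ι → ℝ) (a : ι) (S : Finset ι), (∀ I, |m I| ≤ B) →
      S.card ≤ n → |rootedCumulant m a S| ≤ C := by
  induction n with
  | zero =>
    refine ⟨B, hB, fun m a S hm hS => ?_⟩
    have : S = ∅ := by simpa using hS
    subst this
    rw [rootedCumulant_eq]
    have : (∅ : Finset ι).ssubsets = ∅ := rfl
    simpa [this] using hm {a}
  | succ n ih =>
    obtain ⟨C, hC, h⟩ := ih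
    refine ⟨B + 2 ^ (n + 1) * (C * B), by positivity, fun m a S hm hS => ?_⟩
    rw [rootedCumulant_eq]
    refine (abs_sub _ _).trans (add_le_add (hm _) ?_)
    refine (Finset.abs_sum_le_sum_abs _ _).trans ?_
    have : ∀ J ∈ S.ssubsets, |rootedCumulant m a J * m (S \ J)| ≤ C * B := fun J hJ => by
      rw [abs_mul]
      have := Finset.card_lt_card (Finset.mem_ssubsets.1 hJ)
      gcongr
      · exact h m a J hm (by omega)
      · exact hm _
    refine (Finset.sum_le_card_nsmul _ _ _ this).trans ?_
    rw [nsmul_eq_mul]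
    gcongr
    calc (S.ssubsets.card : ℝ) ≤ (S.powerset.card : ℝ) := by
          exact_mod_cast Finset.card_le_card (Finset.erase_subset _ _)
      _ = 2 ^ S.card := by rw [Finset.card_powerset]; simp
      _ ≤ 2 ^ (n + 1) := by gcongr; norm_num

/-- The joint cumulant of two nearly independent groups of variables is small. -/
lemma exists_abs_rootedCumulant_le_of_split (B : ℝ) (hB : 1 ≤ B) (n : ℕ) :
    ∃ C : ℝ, 0 ≤ C ∧ ∀ (m : Finset ι → ℝ) (a : ι) (S A : Finset ι) (ε : ℝ), m ∅ = 1 →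
      (∀ I, |m I| ≤ B) → a ∈ A → (∀ I, |m I - m (I ∩ A) * m (I \ A)| ≤ ε) →
      S.card ≤ n → ¬ S ⊆ A → |rootedCumulant m a S| ≤ C * ε := by
  induction n with
  | zero =>
    refine ⟨0, le_rfl, fun m a S A ε _ _ _ _ hS hSA => ?_⟩
    have : S = ∅ := by simpa using hS
    simp [this] at hSA
  | succ n ih =>
    obtain ⟨C, hC, h⟩ := ih
    obtain ⟨C₁, hC₁, h₁⟩ := exists_abs_rootedCumulant_le (ι := ι) B (by linarith) (n + 1)
    refine ⟨1 + 2 ^ (n + 1) * (C * B + C₁), by positivity,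
      fun m a S A ε h0 hm ha hε hS hSA => ?_⟩
    have hε0 : 0 ≤ ε := (abs_nonneg _).trans (hε ∅)
    -- Expand `m (insert a S ∩ A)` in cumulants and subtract. Blocks `J ⊆ A` then carry a splitting
    -- error, and the other blocks have small cumulants by induction.
    have key : rootedCumulant m a S = (m (insert a S) - m (insert a S ∩ A) * m (insert a S \ A))
        - ∑ J ∈ S.ssubsets, (if J ⊆ A then rootedCumulant m a J *
            (m (S \ J) - m ((S \ J) ∩ A) * m ((S \ J) \ A))
          else rootedCumulant m a J * m (S \ J)) := by
      -- As `S` is not contained in `A`, every subset of `S ∩ A` is a proper subset of `S`.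
      have e1 : m (insert a S ∩ A) = ∑ J ∈ S.ssubsets,
          if J ⊆ A then rootedCumulant m a J * m ((S \ J) ∩ A) else 0 := by
        rw [Finset.insert_inter_of_mem ha, ← sum_powerset_rootedCumulant h0 a (S ∩ A),
          ← Finset.sum_filter]
        refine Finset.sum_congr ?_ fun J hJ => ?_
        · ext J
          simp only [Finset.mem_powerset, Finset.mem_filter, Finset.mem_ssubsets,
            Finset.subset_inter_iff, Finset.ssubset_iff_subset_ne]
          constructor
          · rintro ⟨h1, h2⟩
            exact ⟨⟨h1, fun e => hSA (e ▸ h2)⟩, h2⟩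
          · rintro ⟨⟨h1, -⟩, h2⟩
            exact ⟨h1, h2⟩
        · rw [Finset.sdiff_inter_right_comm]
      rw [rootedCumulant_eq, e1, Finset.sum_mul, sub_sub, ← Finset.sum_add_distrib]
      congr 1
      refine Finset.sum_congr rfl fun J hJ => ?_
      split_ifs with hJA
      · have : insert a S \ A = (S \ J) \ A := by
          ext x; simp only [Finset.mem_sdiff, Finset.mem_insert]
          constructor
          · rintro ⟨rfl | h1, h2⟩
            · exact absurd ha h2
            · exact ⟨⟨h1, fun h3 => h2 (hJA h3)⟩, h2⟩
          · rintro ⟨⟨h1, -⟩, h2⟩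
            exact ⟨Or.inr h1, h2⟩
        rw [this]; ring
      · ring
    rw [key]
    refine (abs_sub _ _).trans ?_
    rw [add_mul, one_mul]
    refine add_le_add (hε _) ?_
    refine (Finset.abs_sum_le_sum_abs _ _).trans ?_
    have : ∀ J ∈ S.ssubsets, |(if J ⊆ A then rootedCumulant m a J *
            (m (S \ J) - m ((S \ J) ∩ A) * m ((S \ J) \ A))
          else rootedCumulant m a J * m (S \ J))| ≤ (C * B + C₁) * ε := fun J hJ => by
      have hc := Finset.card_lt_card (Finset.mem_ssubsets.1 hJ)
      split_ifs with hJA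
      · rw [abs_mul]
        calc _ ≤ C₁ * ε := mul_le_mul (h₁ m a J hm (by omega)) (hε _) (abs_nonneg _) hC₁
          _ ≤ _ := by
            have : 0 ≤ C * B * ε := by positivity
            linarith
      · rw [abs_mul]
        calc _ ≤ (C * ε) * B := mul_le_mul (h m a J A ε h0 hm ha hε (by omega) hJA) (hm _)
                (abs_nonneg _) (by positivity)
          _ ≤ _ := by
            have : 0 ≤ C₁ * ε := by positivity
            linarith
    refine (Finset.sum_le_card_nsmul _ _ _ this).trans ?_
    rw [nsmul_eq_mul, mul_assoc]
    gcongr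
    calc (S.ssubsets.card : ℝ) ≤ (S.powerset.card : ℝ) := by
          exact_mod_cast Finset.card_le_card (Finset.erase_subset _ _)
      _ = 2 ^ S.card := by rw [Finset.card_powerset]; simp
      _ ≤ 2 ^ (n + 1) := by gcongr; norm_num

lemma rootedCumulant_congr {m m' : Finset ι → ℝ} {a : ι} {S : Finset ι}
    (h : ∀ I ⊆ insert a S, m I = m' I) : rootedCumulant m a S = rootedCumulant m' a S := by
  induction S using Finset.strongInduction with
  | H S ih =>
    rw [rootedCumulant_eq, rootedCumulant_eq, h _ subset_rfl]
    congr 1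
    refine Finset.sum_congr rfl fun J hJ => ?_
    have hJ := Finset.mem_ssubsets.1 hJ
    rw [ih J hJ fun I hI => h I (hI.trans (Finset.insert_subset_insert a hJ.subset)),
      h _ (Finset.sdiff_subset.trans (Finset.subset_insert a S))]

end RootedCumulant

/-! ### Clustering of finite configurations. -/

/-- Multi-scale clustering of a finite configuration: either all its points are close to each
other, or at some scale it splits into at least two clusters of small diameter which are far
apart. -/
lemma exists_separated_clusters {ι : Type*} [Fintype ι] [DecidableEq ι] (e : ι → ι → ℝ)
    (hsymm : ∀ i j, e i j = e j i) (htri : ∀ i j k, e i k ≤ e i j + e j k)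
    (D g : ℕ → ℝ) (hDmono : Monotone D)
    (hg : ∀ j, 2 * D j + g j ≤ D (j + 1)) (n j : ℕ) (c : ι → ι)
    (hc : (Finset.univ.image c).card ≤ n + 1) (hdiam : ∀ i i', c i = c i' → e i i' ≤ D j) :
    (∀ i i', e i i' ≤ D (j + n)) ∨
    ∃ j' ≤ j + n, ∃ c' : ι → ι, (∃ i i', c' i ≠ c' i') ∧
      (∀ i i', c' i = c' i' → e i i' ≤ D j') ∧ (∀ i i', c' i ≠ c' i' → g j' ≤ e i i') := by
  induction n generalizing j c with
  | zero =>
    left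
    intro i i'
    exact hdiam i i' (Finset.card_le_one.1 hc _ (by simp) _ (by simp))
  | succ n ih =>
    by_cases hsep : ∀ i i', c i ≠ c i' → g j ≤ e i i'
    · by_cases hne : ∃ i i', c i ≠ c i'
      · exact Or.inr ⟨j, by omega, c, hne, hdiam, hsep⟩
      · push Not at hne
        left
        exact fun i i' => (hdiam i i' (hne i i')).trans (hDmono (by omega))
    · push Not at hsep
      obtain ⟨p, q, hpq, hlt⟩ := hsep
      -- Merging the cluster of `q` into that of `p` removes a label. The new diameter is at most `2
      -- * D j + g j`, so the scale advances by one.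
      have key := ih (j + 1) (fun i => if c i = c q then c p else c i) ?_ ?_
      · rw [show j + (n + 1) = j + 1 + n by omega]
        exact key
      · have hsub : Finset.univ.image (fun i => if c i = c q then c p else c i)
            ⊆ (Finset.univ.image c).erase (c q) := by
          intro x hx
          obtain ⟨i, -, rfl⟩ := Finset.mem_image.1 hx
          rw [Finset.mem_erase]
          split_ifs with h
          · exact ⟨hpq, by simp⟩
          · exact ⟨h, by simp⟩
        have h1 := Finset.card_le_card hsub
        rw [Finset.card_erase_of_mem (by simp)] at h1
        omega
      · have hD' : D j ≤ D (j + 1) := hDmono (by omega)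
        have aux : ∀ i i', c i = c p → c i' = c q → e i i' ≤ D (j + 1) := fun i i' hi hi' => by
          have h1 := htri i p i'
          have h2 := htri p q i'
          have h3 := hdiam i p hi
          have h4 := hdiam q i' hi'.symm
          have := hg j
          linarith
        intro i i' h
        split_ifs at h with h1 h2 h2
        · exact (hdiam i i' (h1.trans h2.symm)).trans hD'
        · rw [hsymm]; exact aux i' i h.symm h1
        · exact aux i i' h h2
        · exact (hdiam i i' h).trans hD'

/-! ### The method of moments for the Gaussian law. -/

/-- The derivative of each Taylor remainder is `z` times the preceding one, so the bound propagates
by the mean value inequality. Allowing a general `z` covers both `I` and `-I`, hence both signs of a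
real argument. -/
lemma norm_cexp_sub_sum_le_of_re_eq_zero {z : ℂ} (hz : z.re = 0) (hz1 : ‖z‖ ≤ 1) (n : ℕ) {x : ℝ}
    (hx : 0 ≤ x) :
    ‖Complex.exp (x * z) - ∑ k ∈ Finset.range n, (x * z) ^ k / k.factorial‖
      ≤ x ^ n / n.factorial := by
  induction n generalizing x with
  | zero => simp [Complex.norm_exp, hz]
  | succ n ih =>
    have hder : ∀ y : ℝ, HasDerivAt
        (fun y : ℝ => Complex.exp (y * z) - ∑ k ∈ Finset.range (n + 1), (y * z) ^ k / k.factorial)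
        (z * (Complex.exp (y * z) - ∑ k ∈ Finset.range n, (y * z) ^ k / k.factorial)) y := by
      intro y
      have h1 : HasDerivAt (fun y : ℝ => (y : ℂ) * z) z y := by
        simpa using (Complex.ofRealCLM.hasDerivAt (x := y)).mul_const z
      simp_rw [Finset.sum_range_succ']
      have h2 : HasDerivAt (fun y : ℝ => ∑ k ∈ Finset.range n,
          ((y : ℂ) * z) ^ (k + 1) / (k + 1).factorial)
          (∑ k ∈ Finset.range n, (y * z) ^ k / k.factorial * z) y := by
        refine HasDerivAt.fun_sum fun k _ => ?_
        refine ((h1.fun_pow (k + 1)).div_const ((k + 1).factorial : ℂ)).congr_deriv ?_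
        have : (k.factorial : ℂ) ≠ 0 := by exact_mod_cast k.factorial_ne_zero
        have : ((k : ℂ) + 1) ≠ 0 := by exact_mod_cast k.succ_ne_zero
        rw [Nat.factorial_succ]
        push_cast
        field_simp
      simp only [pow_zero]
      refine ((h1.cexp).fun_sub (h2.add_const _)).congr_deriv ?_
      rw [← Finset.sum_mul]
      ring
    have hB : ∀ y : ℝ, HasDerivAt (fun y : ℝ => y ^ (n + 1) / (n + 1).factorial)
        (y ^ n / n.factorial) y := by
      intro y
      refine ((hasDerivAt_pow (n + 1) y).div_const ((n + 1).factorial : ℝ)).congr_deriv ?_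
      have : (n.factorial : ℝ) ≠ 0 := by exact_mod_cast n.factorial_ne_zero
      rw [Nat.factorial_succ]
      push_cast
      field_simp
    refine image_norm_le_of_norm_deriv_right_le_deriv_boundary (a := 0) (b := x)
      (fun y _ => (hder y).continuousAt.continuousWithinAt)
      (fun y _ => (hder y).hasDerivWithinAt) ?_ hB ?_ (Set.right_mem_Icc.2 hx)
    · simp [Finset.sum_range_succ']
    · intro y hy
      rw [norm_mul]
      calc _ ≤ 1 * (y ^ n / n.factorial) := by
            gcongr
            exact ih hy.1
        _ = _ := one_mul _

lemma norm_cexp_I_sub_sum_le (n : ℕ) (x : ℝ) :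
    ‖Complex.exp (x * Complex.I) - ∑ k ∈ Finset.range n, (x * Complex.I) ^ k / k.factorial‖
      ≤ |x| ^ n / n.factorial := by
  rcases le_total 0 x with hx | hx
  · rw [abs_of_nonneg hx]
    exact norm_cexp_sub_sum_le_of_re_eq_zero (by simp) (by simp) n hx
  · rw [abs_of_nonpos hx]
    simpa using norm_cexp_sub_sum_le_of_re_eq_zero (z := -Complex.I) (by simp) (by simp) n
      (neg_nonneg.2 hx)

/-- Taylor expansion of the characteristic function in terms of moments. -/
lemma norm_integral_cexp_sub_sum_le {Ω : Type*} [MeasurableSpace Ω] {P : Measure Ω}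
    [IsProbabilityMeasure P] {X : Ω → ℝ} (hX : AEMeasurable X P)
    (hint : ∀ k, Integrable (fun ω => X ω ^ k) P) (t : ℝ) (n : ℕ) :
    ‖∫ ω, Complex.exp (t * X ω * Complex.I) ∂P - ∑ k ∈ Finset.range (2 * n),
      (t * Complex.I) ^ k / k.factorial * ((∫ ω, X ω ^ k ∂P : ℝ) : ℂ)‖
      ≤ t ^ (2 * n) / (2 * n).factorial * ∫ ω, X ω ^ (2 * n) ∂P := by
  have hexp : Integrable (fun ω => Complex.exp (t * X ω * Complex.I)) P := by
    refine Integrable.of_bound (C := 1) ?_ (ae_of_all _ fun ω => ?_)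
    · have : AEMeasurable (fun ω => Complex.exp (t * X ω * Complex.I)) P := by fun_prop
      exact this.aestronglyMeasurable
    · rw [← Complex.ofReal_mul, Complex.norm_exp_ofReal_mul_I]
  have hterm : ∀ k, Integrable (fun ω => (t * Complex.I) ^ k / k.factorial * ((X ω ^ k : ℝ) : ℂ)) P :=
    fun k => (hint k).ofReal.const_mul _
  have e : ∫ ω, Complex.exp (t * X ω * Complex.I) ∂P - ∑ k ∈ Finset.range (2 * n),
      (t * Complex.I) ^ k / k.factorial * ((∫ ω, X ω ^ k ∂P : ℝ) : ℂ)
      = ∫ ω, (Complex.exp (t * X ω * Complex.I) - ∑ k ∈ Finset.range (2 * n),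
      (t * Complex.I) ^ k / k.factorial * ((X ω ^ k : ℝ) : ℂ)) ∂P := by
    rw [integral_sub hexp (integrable_finsetSum _ fun k _ => hterm k),
      integral_finsetSum _ fun k _ => hterm k]
    congr 1
    refine Finset.sum_congr rfl fun k _ => ?_
    rw [integral_const_mul, integral_complex_ofReal]
  rw [e, ← integral_const_mul]
  refine norm_integral_le_of_norm_le ((hint _).const_mul _) (ae_of_all _ fun ω => ?_)
  have := norm_cexp_I_sub_sum_le (2 * n) (t * X ω)
  -- The even order removes the absolute value, so the remainder is controlled by a genuine moment.
  rw [pow_mul |t * X ω|, sq_abs, ← pow_mul, mul_pow] at this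
  convert this using 1
  · congr 2
    · push_cast; rfl
    · refine Finset.sum_congr rfl fun k _ => ?_
      push_cast
      ring
  · ring

/-- The moments of the centred Gaussian law of variance `v`. -/
noncomputable def gaussianMoment (v : ℝ) : ℕ → ℝ
  | 0 => 1
  | 1 => 0
  | n + 2 => (n + 1) * v * gaussianMoment v n

lemma gaussianMoment_odd (v : ℝ) (n : ℕ) : gaussianMoment v (2 * n + 1) = 0 := by
  induction n with
  | zero => rfl
  | succ n ih =>
    rw [show 2 * (n + 1) + 1 = (2 * n + 1) + 2 by ring, gaussianMoment, ih, mul_zero]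

lemma gaussianMoment_even (v : ℝ) (n : ℕ) :
    gaussianMoment v (2 * n) = (2 * n).factorial * ((v / 2) ^ n / n.factorial) := by
  induction n with
  | zero => simp [gaussianMoment]
  | succ n ih =>
    rw [show 2 * (n + 1) = (2 * n) + 2 by ring, gaussianMoment, ih, Nat.factorial_succ,
      Nat.factorial_succ, Nat.factorial_succ]
    have : (n.factorial : ℝ) ≠ 0 := by exact_mod_cast n.factorial_ne_zero
    push_cast
    field_simp
    ring

/-- Odd terms vanish, and the even ones are the exponential series at `-(v * t ^ 2 / 2)`. -/
lemma sum_gaussianMoment (v t : ℝ) (n : ℕ) :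
    ∑ k ∈ Finset.range (2 * n), (t * Complex.I) ^ k / k.factorial * (gaussianMoment v k : ℂ)
      = ∑ j ∈ Finset.range n, ((-(v * t ^ 2 / 2) : ℝ) : ℂ) ^ j / j.factorial := by
  induction n with
  | zero => simp
  | succ n ih =>
    rw [show 2 * (n + 1) = 2 * n + 1 + 1 by ring, Finset.sum_range_succ, Finset.sum_range_succ, ih,
      Finset.sum_range_succ, gaussianMoment_odd, gaussianMoment_even]
    have h1 : ((2 * n).factorial : ℂ) ≠ 0 := by exact_mod_cast (2 * n).factorial_ne_zero
    have h2 : (t * Complex.I) ^ (2 * n) = (-(t : ℂ) ^ 2) ^ n := by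
      rw [pow_mul, mul_pow, Complex.I_sq]; ring
    have h3 : ((-(v * t ^ 2 / 2) : ℝ) : ℂ) ^ n = (-(t : ℂ) ^ 2) ^ n * ((v : ℂ) / 2) ^ n := by
      rw [← mul_pow]; push_cast; ring
    rw [h2, h3]
    push_cast
    field_simp
    simp

/-- Method of moments for the Gaussian law, at the level of characteristic functions. -/
lemma tendsto_integral_cexp_of_tendsto_moment {Ω : Type*} [MeasurableSpace Ω] {P : Measure Ω}
    [IsProbabilityMeasure P] {X : ℕ → Ω → ℝ} (hX : ∀ T, AEMeasurable (X T) P)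
    (hint : ∀ T k, Integrable (fun ω => X T ω ^ k) P) {v : ℝ}
    (hmom : ∀ k, Tendsto (fun T => ∫ ω, X T ω ^ k ∂P) atTop (𝓝 (gaussianMoment v k))) (t : ℝ) :
    Tendsto (fun T => ∫ ω, Complex.exp (t * X T ω * Complex.I) ∂P) atTop
      (𝓝 (Complex.exp ((-(v * t ^ 2 / 2) : ℝ) : ℂ))) := by
  have hu : ∀ n, t ^ (2 * n) / (2 * n).factorial * gaussianMoment v (2 * n)
      = (v * t ^ 2 / 2) ^ n / n.factorial := fun n => by
    have h1 : ((2 * n).factorial : ℝ) ≠ 0 := by exact_mod_cast (2 * n).factorial_ne_zero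
    rw [gaussianMoment_even, pow_mul, show v * t ^ 2 / 2 = t ^ 2 * (v / 2) by ring, mul_pow]
    field_simp
  rw [Metric.tendsto_atTop]
  intro ε hε
  -- One truncation order serves twice: the first quantity is the limit of the Taylor remainder
  -- bounds, the second is the tail of the Gaussian series.
  obtain ⟨n, hn1, hn2⟩ : ∃ n, (v * t ^ 2 / 2) ^ n / n.factorial < ε / 4 ∧
      ‖∑ j ∈ Finset.range n, ((-(v * t ^ 2 / 2) : ℝ) : ℂ) ^ j / j.factorial
        - Complex.exp ((-(v * t ^ 2 / 2) : ℝ) : ℂ)‖ < ε / 4 := by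
    have h1 := (FloorSemiring.tendsto_pow_div_factorial_atTop (v * t ^ 2 / 2)).eventually
      (gt_mem_nhds (show 0 < ε / 4 by positivity))
    have h2 := (NormedSpace.expSeries_div_hasSum_exp
      (((-(v * t ^ 2 / 2) : ℝ) : ℂ))).tendsto_sum_nat
    rw [← Complex.exp_eq_exp_ℂ] at h2
    have h2 := Metric.tendsto_nhds.1 h2 (ε / 4) (by positivity)
    simp_rw [dist_eq_norm] at h2
    exact (h1.and h2).exists
  have h3 : Tendsto (fun T => t ^ (2 * n) / (2 * n).factorial * ∫ ω, X T ω ^ (2 * n) ∂P) atTop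
      (𝓝 ((v * t ^ 2 / 2) ^ n / n.factorial)) := by
    rw [← hu]
    exact (hmom _).const_mul _
  have h4 : Tendsto (fun T => ∑ k ∈ Finset.range (2 * n),
      (t * Complex.I) ^ k / k.factorial * ((∫ ω, X T ω ^ k ∂P : ℝ) : ℂ)) atTop
      (𝓝 (∑ j ∈ Finset.range n, ((-(v * t ^ 2 / 2) : ℝ) : ℂ) ^ j / j.factorial)) := by
    rw [← sum_gaussianMoment]
    refine tendsto_finsetSum _ fun k _ => Tendsto.const_mul _ ?_
    exact (Complex.continuous_ofReal.tendsto _).comp (hmom k)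
  have h3 := h3.eventually (gt_mem_nhds hn1)
  have h4 := Metric.tendsto_nhds.1 h4 (ε / 4) (by positivity)
  obtain ⟨T₀, hT₀⟩ := eventually_atTop.1 (h3.and h4)
  refine ⟨T₀, fun T hT => ?_⟩
  obtain ⟨h3, h4⟩ := hT₀ T hT
  have h5 := norm_integral_cexp_sub_sum_le (hX T) (hint T) t n
  rw [← dist_eq_norm] at h5 hn2
  have := dist_triangle4 (∫ ω, Complex.exp (t * X T ω * Complex.I) ∂P)
    (∑ k ∈ Finset.range (2 * n), (t * Complex.I) ^ k / k.factorial * ((∫ ω, X T ω ^ k ∂P : ℝ) : ℂ))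
    (∑ j ∈ Finset.range n, ((-(v * t ^ 2 / 2) : ℝ) : ℂ) ^ j / j.factorial)
    (Complex.exp ((-(v * t ^ 2 / 2) : ℝ) : ℂ))
  linarith

lemma tendstoInDistribution_gaussianReal_of_tendsto_moment {Ω : Type*} [MeasurableSpace Ω]
    {P : Measure Ω} [IsProbabilityMeasure P] {X : ℕ → Ω → ℝ} (hX : ∀ T, AEMeasurable (X T) P)
    (hint : ∀ T k, Integrable (fun ω => X T ω ^ k) P) {v : ℝ≥0}
    (hmom : ∀ k, Tendsto (fun T => ∫ ω, X T ω ^ k ∂P) atTop (𝓝 (gaussianMoment v k))) :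
    TendstoInDistribution X atTop (id : ℝ → ℝ) (fun _ => P) (gaussianReal 0 v) where
  forall_aemeasurable := hX
  aemeasurable_limit := aemeasurable_id
  tendsto := by
    refine ProbabilityMeasure.tendsto_iff_tendsto_charFun.2 fun t => ?_
    have := tendsto_integral_cexp_of_tendsto_moment hX hint hmom t
    simp only [ProbabilityMeasure.coe_mk, Measure.map_id]
    rw [charFun_gaussianReal]
    convert this using 2 with T
    · rw [charFun_apply_real, integral_map (hX T)]
      have : Measurable (fun x : ℝ => Complex.exp (t * x * Complex.I)) := by fun_prop
      exact this.aestronglyMeasurable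
    · push_cast; congr 1; ring

/-! ### Cumulants of a moment sequence. -/

/-- The cumulants of a sequence of moments, through the moment-cumulant recursion
`M (n + 1) = ∑ k ≤ n, n.choose k * K k * M (n - k)`; the index is shifted by one. -/
noncomputable def momentCumulant (M : ℕ → ℝ) (n : ℕ) : ℝ :=
  M (n + 1) - ∑ k : Fin n, n.choose k * (momentCumulant M k * M (n - k))

lemma momentCumulant_zero (M : ℕ → ℝ) : momentCumulant M 0 = M 1 := by
  rw [momentCumulant]; simp

lemma momentCumulant_one (M : ℕ → ℝ) : momentCumulant M 1 = M 2 - M 1 * M 1 := by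
  rw [momentCumulant]; simp [momentCumulant_zero]

lemma moment_succ_eq_sum {M : ℕ → ℝ} (h0 : M 0 = 1) (n : ℕ) :
    M (n + 1) = ∑ k ∈ Finset.range (n + 1), n.choose k * (momentCumulant M k * M (n - k)) := by
  rw [Finset.sum_range_succ, momentCumulant,
    Finset.sum_range (fun k => (n.choose k : ℝ) * (momentCumulant M k * M (n - k)))]
  simp [h0]

/-- The Gaussian moment recursion is the moment-cumulant recursion in which only the second cumulant
(index 1) survives; the limit passes through it by strong induction. -/
lemma tendsto_moment_of_tendsto_momentCumulant {M : ℕ → ℕ → ℝ} {v : ℝ} (h0 : ∀ T, M T 0 = 1)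
    (h1 : Tendsto (fun T => momentCumulant (M T) 0) atTop (𝓝 0))
    (h2 : Tendsto (fun T => momentCumulant (M T) 1) atTop (𝓝 v))
    (h3 : ∀ n, 2 ≤ n → Tendsto (fun T => momentCumulant (M T) n) atTop (𝓝 0)) (k : ℕ) :
    Tendsto (fun T => M T k) atTop (𝓝 (gaussianMoment v k)) := by
  have hK : ∀ n, Tendsto (fun T => momentCumulant (M T) n) atTop (𝓝 (if n = 1 then v else 0)) := by
    intro n
    rcases n with _ | _ | n
    · simpa using h1
    · simpa using h2
    · simpa using h3 (n + 2) (by omega)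
  induction k using Nat.strong_induction_on with
  | _ k ih =>
    rcases k with _ | n
    · simp only [h0, gaussianMoment]; exact tendsto_const_nhds
    · simp_rw [fun T => moment_succ_eq_sum (h0 T) n]
      have : gaussianMoment v (n + 1) = ∑ k ∈ Finset.range (n + 1),
          n.choose k * ((if k = 1 then v else 0) * gaussianMoment v (n - k)) := by
        simp only [ite_mul, zero_mul, mul_ite, mul_zero, Finset.sum_ite_eq', Finset.mem_range]
        rcases n with _ | n
        · simp [gaussianMoment]
        · simp [gaussianMoment]; ring
      rw [this]
      refine tendsto_finsetSum _ fun k hk => Tendsto.const_mul _ ((hK k).mul (ih _ ?_))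
      omega

/-! ### Mixed moments of translates. -/

section MixedMoment

variable {H X ι : Type*} [Group H] [MeasurableSpace X] [MulAction H X]

/-- The mixed moments `μ(∏ i ∈ I, h_i · g)` of the translates of `g`. -/
noncomputable def mixedMoment (μ : Measure X) (g : X → ℝ) (h : ι → H) (I : Finset ι) : ℝ :=
  ∫ x, ∏ i ∈ I, g ((h i)⁻¹ • x) ∂μ

lemma mixedMoment_empty (μ : Measure X) [IsProbabilityMeasure μ] (g : X → ℝ) (h : ι → H) :
    mixedMoment μ g h ∅ = 1 := by
  simp [mixedMoment]

lemma dependsOn_mixedMoment (μ : Measure X) (g : X → ℝ) (I : Finset ι) :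
    DependsOn (fun h : ι → H => mixedMoment μ g h I) I := by
  intro h h' hh
  simp only [mixedMoment]
  congr 1
  funext x
  exact Finset.prod_congr rfl fun i hi => by rw [hh i hi]

lemma dependsOn_rootedCumulant [DecidableEq ι] (μ : Measure X) (g : X → ℝ) (a : ι) (S : Finset ι) :
    DependsOn (fun h : ι → H => rootedCumulant (mixedMoment μ g h) a S)
      (insert a S : Finset ι) := fun _ _ hh =>
  rootedCumulant_congr fun I hI => dependsOn_mixedMoment μ g I fun i hi => hh i (hI hi)

lemma abs_prod_le_pow_card {L : ℝ} (hL : 1 ≤ L) [Fintype ι] (I : Finset ι) {φ : ι → ℝ}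
    (hφ : ∀ i, |φ i| ≤ L) : |∏ i ∈ I, φ i| ≤ L ^ Fintype.card ι := by
  rw [Finset.abs_prod]
  calc ∏ i ∈ I, |φ i| ≤ ∏ _i ∈ I, L := Finset.prod_le_prod (fun _ _ => abs_nonneg _) fun i _ => hφ i
    _ = L ^ I.card := by simp
    _ ≤ _ := pow_le_pow_right₀ hL (Finset.card_le_univ I)

lemma abs_mixedMoment_le [Fintype ι] (μ : Measure X) [IsProbabilityMeasure μ] {g : X → ℝ} {L : ℝ}
    (hL : 1 ≤ L) (hg : ∀ x, |g x| ≤ L) (h : ι → H) (I : Finset ι) :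
    |mixedMoment μ g h I| ≤ L ^ Fintype.card ι := by
  have := norm_integral_le_of_norm_le_const (μ := μ) (f := fun x => ∏ i ∈ I, g ((h i)⁻¹ • x))
    (ae_of_all _ fun x => abs_prod_le_pow_card hL I (φ := fun i => g ((h i)⁻¹ • x)) fun i => hg _)
  simpa [mixedMoment] using this

/-- Approximate factorization over the clusters of a labelling gives approximate factorization
over one cluster and its complement. -/
lemma abs_sub_mul_le_of_clusters [DecidableEq ι] {m : Finset ι → ℝ} (h0 : m ∅ = 1)
    {lab : ι → ι} {ε B : ℝ} (hB : ∀ I, |m I| ≤ B)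
    (hε : ∀ I, |m I - ∏ q ∈ I.image lab, m (I.filter (lab · = q))| ≤ ε) {A : Finset ι} {q₀ : ι}
    (hA : ∀ i, i ∈ A ↔ lab i = q₀) (I : Finset ι) :
    |m I - m (I ∩ A) * m (I \ A)| ≤ (1 + B) * ε := by
  have hprod : ∏ q ∈ I.image lab, m (I.filter (lab · = q))
      = m (I ∩ A) * ∏ q ∈ (I \ A).image lab, m ((I \ A).filter (lab · = q)) := by
    have e2 : ∀ q ∈ (I \ A).image lab, m ((I \ A).filter (lab · = q)) = m (I.filter (lab · = q)) := by
      intro q hq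
      congr 1
      obtain ⟨j, hj, rfl⟩ := Finset.mem_image.1 hq
      rw [Finset.mem_sdiff, hA] at hj
      ext i
      simp only [Finset.mem_filter, Finset.mem_sdiff, hA]
      constructor
      · rintro ⟨⟨h1, -⟩, h2⟩; exact ⟨h1, h2⟩
      · rintro ⟨h1, h2⟩; exact ⟨⟨h1, h2 ▸ hj.2⟩, h2⟩
    have hIA : I ∩ A = I.filter (lab · = q₀) := by ext i; simp [hA]
    have e3 : (I \ A).image lab = (I.image lab).erase q₀ := by
      ext q
      simp only [Finset.mem_image, Finset.mem_sdiff, Finset.mem_erase, hA]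
      constructor
      · rintro ⟨i, ⟨h1, h2⟩, rfl⟩; exact ⟨h2, i, h1, rfl⟩
      · rintro ⟨h1, i, h2, rfl⟩; exact ⟨i, ⟨h2, h1⟩, rfl⟩
    rw [Finset.prod_congr rfl e2, e3, hIA]
    -- If `I` misses the label `q₀`, the factor split off is `m ∅ = 1`.
    by_cases hq : q₀ ∈ I.image lab
    · rw [Finset.mul_prod_erase _ (fun q => m (I.filter (lab · = q))) hq]
    · rw [Finset.erase_eq_of_notMem hq, Finset.filter_eq_empty_iff.2, h0, one_mul]
      intro i hi e
      exact hq (Finset.mem_image.2 ⟨i, hi, e⟩)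
  have h1 := hε I
  rw [hprod] at h1
  have h2 : |m (I ∩ A) * (m (I \ A) - ∏ q ∈ (I \ A).image lab, m ((I \ A).filter (lab · = q)))|
      ≤ B * ε := by
    rw [abs_mul]
    exact mul_le_mul (hB _) (hε _) (abs_nonneg _) ((abs_nonneg _).trans (hB ∅))
  calc _ = |(m I - m (I ∩ A) * ∏ q ∈ (I \ A).image lab, m ((I \ A).filter (lab · = q)))
        - m (I ∩ A) * (m (I \ A) - ∏ q ∈ (I \ A).image lab, m ((I \ A).filter (lab · = q)))| := by
        congr 1; ring
    _ ≤ ε + B * ε := (abs_sub _ _).trans (add_le_add h1 h2)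
    _ = _ := by ring

end MixedMoment

/-! ### Exponential mixing and factorization over clusters. -/

lemma IsLeftInvariantMetric.self {H : Type*} [Group H] [MeasurableSpace H] {d : H → H → ℝ}
    (hd : IsLeftInvariantMetric d) (x : H) : d x x = 0 := (hd.eq_zero_iff x x).2 rfl

lemma IsLeftInvariantMetric.nonneg {H : Type*} [Group H] [MeasurableSpace H] {d : H → H → ℝ}
    (hd : IsLeftInvariantMetric d) (x y : H) : 0 ≤ d x y := by
  have h1 := hd.triangle x y x
  rw [hd.self, hd.symm y x] at h1
  linarith

section Mixing

variable {H X : Type*} [Group H] [MeasurableSpace H] [MeasurableSpace X] [MulAction H X]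
  [MeasurableSMul₂ H X] {μ : Measure X} [SMulInvariantMeasure H X μ]

lemma LInfty.coeFn_mul (f g : Lp ℝ ∞ μ) : ⇑(LInfty.mul f g) =ᵐ[μ] fun x => f x * g x :=
  MemLp.coeFn_toLp _

lemma LInfty.coeFn_translate (h : H) (f : Lp ℝ ∞ μ) :
    ⇑(LInfty.translate h f) =ᵐ[μ] fun x => f (h⁻¹ • x) :=
  Lp.coeFn_compMeasurePreserving f (measurePreserving_smul h⁻¹ μ)

lemma InvariantSubalgebra.coeFn_translate_congr (A : InvariantSubalgebra H μ) (h : H)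
    {F : A.toSubmodule} {φ : X → ℝ} (hF : (F : Lp ℝ ∞ μ) =ᵐ[μ] φ) :
    (A.translate h F : Lp ℝ ∞ μ) =ᵐ[μ] fun x => φ (h⁻¹ • x) :=
  (LInfty.coeFn_translate h F.1).trans
    ((measurePreserving_smul h⁻¹ μ).quasiMeasurePreserving.ae_eq_comp hF)

variable {A : InvariantSubalgebra H μ} {d : H → H → ℝ} {N : ℕ → Seminorm ℝ A.toSubmodule}

/-- Products of translates by group elements near the identity have controlled norms. -/
lemma InvariantSubalgebra.IsAdmissible.exists_prod_translate {ι : Type*} [DecidableEq ι]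
    (hN : A.IsAdmissible d N) (f : A.toSubmodule) {g : X → ℝ} (hg : (f : Lp ℝ ∞ μ) =ᵐ[μ] g)
    (n s : ℕ) (hs : 1 ≤ s) :
    ∃ C a : ℝ, 0 ≤ C ∧ 0 ≤ a ∧ ∀ (D : ℝ) (T : Finset ι) (u : ι → H), 0 ≤ D → T.Nonempty →
      T.card ≤ n → (∀ i ∈ T, d (u i) 1 ≤ D) → ∃ F : A.toSubmodule,
        ((F : Lp ℝ ∞ μ) =ᵐ[μ] fun x => ∏ i ∈ T, g ((u i)⁻¹ • x)) ∧ N s F ≤ C * Real.exp (a * D) := by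
  induction n generalizing s with
  | zero =>
    refine ⟨0, 0, le_rfl, le_rfl, fun D T u _ hT hT' => ?_⟩
    simp [hT.ne_empty] at hT'
  | succ n ih =>
    -- Each multiplication costs one index of the semi-norms, so the remaining product is controlled
    -- at `s + 1`.
    obtain ⟨C₁, a₁, hC₁, ha₁, h₁⟩ := ih (s + 1) (by omega)
    obtain ⟨σ, hσ, Cb, hb⟩ := hN.bounded s hs
    obtain ⟨σ', hσ', Cb', hb'⟩ := hN.bounded (s + 1) (by omega)
    obtain ⟨Cm, hm⟩ := hN.almost_mul s hs
    refine ⟨|Cb| * N s f + |Cm| * ((|Cb'| * N (s + 1) f) * C₁), σ + (σ' + a₁), by positivity,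
      by positivity, fun D T u hD hT hT' hu => ?_⟩
    have tr : ∀ (t : ℕ) (σ C : ℝ), 0 < σ →
        (∀ (f : A.toSubmodule) (h : H), N t (A.translate h f) ≤ C * Real.exp (σ * d h 1) * N t f) →
        ∀ i ∈ T, N t (A.translate (u i) f) ≤ |C| * N t f * Real.exp (σ * D) := by
      intro t σ C hσ hb i hi
      calc _ ≤ C * Real.exp (σ * d (u i) 1) * N t f := hb f (u i)
        _ ≤ |C| * Real.exp (σ * D) * N t f := by
          gcongr
          · exact le_abs_self C
          · exact hu i hi
        _ = _ := by ring
    have hpos₁ : 0 ≤ |Cb| * N s f := by positivity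
    have hpos₂ : 0 ≤ |Cm| * ((|Cb'| * N (s + 1) f) * C₁) := by positivity
    obtain ⟨i, hi⟩ := hT
    -- The algebra need not contain constants, so the empty product is unavailable and a single
    -- translate is a separate case.
    rcases (T.erase i).eq_empty_or_nonempty with he | hne
    · have hTi : T = {i} := by
        rw [← Finset.insert_erase hi, he]; rfl
      refine ⟨A.translate (u i) f, ?_, (tr s σ Cb hσ hb i hi).trans ?_⟩
      · simpa [hTi] using A.coeFn_translate_congr (u i) hg
      · gcongr
        · linarith
        · linarith
    · obtain ⟨F, hF, hNF⟩ := h₁ D (T.erase i) u hD hne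
        (by rw [Finset.card_erase_of_mem hi]; omega) fun j hj => hu j (Finset.mem_of_mem_erase hj)
      refine ⟨A.mul (A.translate (u i) f) F, ?_, ?_⟩
      · filter_upwards [LInfty.coeFn_mul (A.translate (u i) f).1 F.1, hF,
          A.coeFn_translate_congr (u i) hg] with x h1 h2 h3
        rw [← Finset.mul_prod_erase T _ hi, ← h2, ← h3]
        exact h1
      · calc _ ≤ Cm * (N (s + 1) (A.translate (u i) f) * N (s + 1) F) := hm _ _
          _ ≤ |Cm| * ((|Cb'| * N (s + 1) f * Real.exp (σ' * D)) * (C₁ * Real.exp (a₁ * D))) := by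
            gcongr
            · exact le_abs_self Cm
            · exact tr (s + 1) σ' Cb' hσ' hb' i hi
          _ = |Cm| * ((|Cb'| * N (s + 1) f) * C₁) * Real.exp ((σ' + a₁) * D) := by
            rw [add_mul, Real.exp_add]; ring
          _ ≤ _ := by
            gcongr ?_ * Real.exp (?_ * D) <;> linarith

/-- Mixed moments of a configuration made of exactly `k ≥ 2` separated clusters nearly
factorize. -/
lemma InvariantSubalgebra.ExpMixing.exists_abs_mixedMoment_sub_prod_le {ι : Type*} [Fintype ι]
    [DecidableEq ι] (hd : IsLeftInvariantMetric d) (hN : A.IsAdmissible d N) {k : ℕ}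
    (hmix : A.ExpMixing d N k) (hk : 2 ≤ k)
    (f : A.toSubmodule) {g : X → ℝ} (hg : (f : Lp ℝ ∞ μ) =ᵐ[μ] g) :
    ∃ δ a C : ℝ, 0 < δ ∧ 0 ≤ a ∧ 0 ≤ C ∧ ∀ (h : ι → H) (I : Finset ι) (lab : ι → ι) (D gap : ℝ),
      (I.image lab).card = k → 0 ≤ D → (∀ i i', lab i = lab i' → d (h i) (h i') ≤ D) →
      (∀ i i', lab i ≠ lab i' → gap ≤ d (h i) (h i')) →
      |mixedMoment μ g h I - ∏ q ∈ I.image lab, mixedMoment μ g h (I.filter (lab · = q))|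
        ≤ C * Real.exp (a * D - δ * gap) := by
  obtain ⟨δ, hδ, s₀, hs₀, hs⟩ := hmix
  obtain ⟨C₀, hC₀⟩ := hs (s₀ + 1) (by omega)
  obtain ⟨C₁, a₁, hC₁, ha₁, h₁⟩ := hN.exists_prod_translate (ι := ι) f hg (Fintype.card ι) (s₀ + 1)
    (by omega)
  refine ⟨δ, k * a₁, |C₀| * C₁ ^ k, hδ, by positivity, by positivity,
    fun h I lab D gap hcard hD hdiam hsep => ?_⟩
  let e : Fin k ≃ I.image lab := (Finset.equivFinOfCardEq hcard).symm
  have hex : ∀ j : Fin k, ∃ i ∈ I, lab i = (e j : ι) := fun j => Finset.mem_image.1 (e j).2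
  choose p hpI hp using hex
  -- Recentred at its representative `h (p j)`, a cluster lies within `D` of the identity by left
  -- invariance. Its product is thus the translate by `h (p j)` of an element of norm at most `C₁ *
  -- exp (a₁ * D)`.
  have hF : ∀ j : Fin k, ∃ F : A.toSubmodule,
      ((F : Lp ℝ ∞ μ) =ᵐ[μ] fun x => ∏ i ∈ I.filter (lab · = (e j : ι)),
        g (((h (p j))⁻¹ * h i)⁻¹ • x)) ∧ N (s₀ + 1) F ≤ C₁ * Real.exp (a₁ * D) := by
    intro j
    refine h₁ D (I.filter (lab · = (e j : ι))) (fun i => (h (p j))⁻¹ * h i) hD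
      ⟨p j, by simp [hpI, hp]⟩ (Finset.card_le_univ _) fun i hi => ?_
    have : d ((h (p j))⁻¹ * h i) 1 = d (h i) (h (p j)) := by
      rw [← hd.left_invariant (h (p j)) ((h (p j))⁻¹ * h i) 1]; simp
    rw [this]
    exact hdiam _ _ ((Finset.mem_filter.1 hi).2.trans (hp j).symm)
  choose F hFae hFN using hF
  have htr : ∀ j : Fin k, (A.translate (h (p j)) (F j) : Lp ℝ ∞ μ) =ᵐ[μ]
      fun x => ∏ i ∈ I.filter (lab · = (e j : ι)), g ((h i)⁻¹ • x) := by
    intro j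
    refine (A.coeFn_translate_congr (h (p j)) (hFae j)).trans (Eventually.of_forall fun x => ?_)
    refine Finset.prod_congr rfl fun i _ => ?_
    simp [smul_smul]
  have hint : ∀ j : Fin k, ∫ x, (F j : Lp ℝ ∞ μ) x ∂μ
      = mixedMoment μ g h (I.filter (lab · = (e j : ι))) := by
    intro j
    rw [mixedMoment, ← integral_congr_ae (htr j)]
    refine Eq.trans ?_ (integral_congr_ae (LInfty.coeFn_translate (h (p j)) (F j).1)).symm
    exact (integral_smul_eq_self (fun x => (F j : Lp ℝ ∞ μ) x) (g := (h (p j))⁻¹)).symm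
  have hprod : ∀ φ : ι → ℝ, ∏ j : Fin k, φ (e j) = ∏ q ∈ I.image lab, φ q := fun φ => by
    rw [Equiv.prod_comp e (fun q => φ q), Finset.prod_coe_sort]
  have key := hC₀ F fun j => h (p j)
  have e1 : ∫ x, ∏ j, (A.translate (h (p j)) (F j) : Lp ℝ ∞ μ) x ∂μ = mixedMoment μ g h I := by
    refine integral_congr_ae ?_
    filter_upwards [ae_all_iff.2 htr] with x hx
    rw [Finset.prod_congr rfl fun j _ => hx j,
      hprod (fun q => ∏ i ∈ I.filter (lab · = q), g ((h i)⁻¹ • x))]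
    exact Finset.prod_fiberwise_of_maps_to (fun i hi => Finset.mem_image_of_mem lab hi) _
  have e2 : ∏ j, ∫ x, (F j : Lp ℝ ∞ μ) x ∂μ
      = ∏ q ∈ I.image lab, mixedMoment μ g h (I.filter (lab · = q)) := by
    rw [Finset.prod_congr rfl fun j _ => hint j,
      hprod (fun q => mixedMoment μ g h (I.filter (lab · = q)))]
  rw [e1, e2] at key
  refine key.trans ?_
  have hsep' : gap ≤ minSeparation d fun j => h (p j) := by
    have : Nonempty {q : Fin k × Fin k // q.1 ≠ q.2} :=
      ⟨⟨(⟨0, by omega⟩, ⟨1, by omega⟩), by simp⟩⟩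
    refine le_ciInf fun q => hsep _ _ ?_
    rw [hp, hp]
    exact fun h => q.2 (e.injective (Subtype.ext h))
  calc _ ≤ |C₀| * Real.exp (-δ * gap) * ∏ _j : Fin k, (C₁ * Real.exp (a₁ * D)) := by
        refine mul_le_mul (mul_le_mul (le_abs_self _) ?_ (by positivity) (by positivity))
          (Finset.prod_le_prod (fun _ _ => apply_nonneg _ _) fun j _ => hFN j)
          (Finset.prod_nonneg fun _ _ => apply_nonneg _ _) (by positivity)
        rw [Real.exp_le_exp]
        nlinarith
    _ = |C₀| * C₁ ^ k * (Real.exp (-δ * gap) * Real.exp (k * (a₁ * D))) := by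
        rw [Finset.prod_const, Finset.card_univ, Fintype.card_fin, mul_pow, ← Real.exp_nat_mul]
        ring
    _ = _ := by rw [← Real.exp_add]; congr 2; ring

/-- Mixed moments of a configuration made of separated clusters nearly factorize. -/
lemma InvariantSubalgebra.ExpMixingAllOrders.exists_abs_mixedMoment_sub_prod_le {ι : Type*}
    [Fintype ι] [DecidableEq ι] [IsProbabilityMeasure μ] (hd : IsLeftInvariantMetric d)
    (hN : A.IsAdmissible d N) (hmix : A.ExpMixingAllOrders d N)
    (f : A.toSubmodule) {g : X → ℝ} (hg : (f : Lp ℝ ∞ μ) =ᵐ[μ] g) :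
    ∃ δ a C : ℝ, 0 < δ ∧ 0 ≤ a ∧ 0 ≤ C ∧ ∀ (h : ι → H) (I : Finset ι) (lab : ι → ι) (D gap : ℝ),
      0 ≤ D → 0 ≤ gap → (∀ i i', lab i = lab i' → d (h i) (h i') ≤ D) →
      (∀ i i', lab i ≠ lab i' → gap ≤ d (h i) (h i')) →
      |mixedMoment μ g h I - ∏ q ∈ I.image lab, mixedMoment μ g h (I.filter (lab · = q))|
        ≤ C * Real.exp (a * D - δ * gap) := by
  -- The mixing constants depend on the number of clusters, which is at most the cardinality of `ι`;
  -- the induction merges finitely many of them by `min` and `max`.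
  suffices H : ∀ n : ℕ, ∃ δ a C : ℝ, 0 < δ ∧ 0 ≤ a ∧ 0 ≤ C ∧
      ∀ (h : ι → H) (I : Finset ι) (lab : ι → ι) (D gap : ℝ), (I.image lab).card ≤ n + 1 →
      0 ≤ D → 0 ≤ gap → (∀ i i', lab i = lab i' → d (h i) (h i') ≤ D) →
      (∀ i i', lab i ≠ lab i' → gap ≤ d (h i) (h i')) →
      |mixedMoment μ g h I - ∏ q ∈ I.image lab, mixedMoment μ g h (I.filter (lab · = q))|
        ≤ C * Real.exp (a * D - δ * gap) by
    obtain ⟨δ, a, C, hδ, ha, hC, h⟩ := H (Fintype.card ι)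
    exact ⟨δ, a, C, hδ, ha, hC, fun u I lab D gap =>
      h u I lab D gap ((Finset.card_le_univ _).trans (Nat.le_succ _))⟩
  intro n
  induction n with
  | zero =>
    refine ⟨1, 0, 0, one_pos, le_rfl, le_rfl, fun h I lab D gap hI _ _ _ _ => ?_⟩
    rcases I.eq_empty_or_nonempty with rfl | ⟨i, hi⟩
    · simp [mixedMoment_empty]
    · have h1 : ∀ j ∈ I, lab j = lab i := fun j hj =>
        Finset.card_le_one.1 hI _ (Finset.mem_image_of_mem _ hj) _ (Finset.mem_image_of_mem _ hi)
      have h2 : I.image lab = {lab i} := by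
        ext q
        simp only [Finset.mem_image, Finset.mem_singleton]
        constructor
        · rintro ⟨j, hj, rfl⟩; exact h1 j hj
        · rintro rfl; exact ⟨i, hi, rfl⟩
      rw [h2, Finset.prod_singleton, Finset.filter_true_of_mem h1]
      simp
  | succ n ih =>
    obtain ⟨δ, a, C, hδ, ha, hC, h⟩ := ih
    obtain ⟨δ', a', C', hδ', ha', hC', h'⟩ :=
      (hmix (n + 2) (by omega)).exists_abs_mixedMoment_sub_prod_le (ι := ι) hd hN (by omega) f hg
    refine ⟨min δ δ', max a a', max C C', lt_min hδ hδ', le_max_of_le_left ha, le_max_of_le_left hC,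
      fun u I lab D gap hI hD hgap hdiam hsep => ?_⟩
    rcases Nat.lt_or_ge (n + 1) (I.image lab).card with hlt | hge
    · refine (h' u I lab D gap (by omega) hD hdiam hsep).trans ?_
      gcongr
      · exact le_max_right _ _
      · exact le_max_right _ _
      · exact min_le_right _ _
    · refine (h u I lab D gap hge hD hgap hdiam hsep).trans ?_
      gcongr
      · exact le_max_left _ _
      · exact le_max_left _ _
      · exact min_le_left _ _

/-- Either a configuration of points is contained in a ball of logarithmic size, or the
corresponding joint cumulant is as small as any prescribed power. -/
lemma InvariantSubalgebra.ExpMixingAllOrders.exists_dist_le_or_abs_rootedCumulant_le {ι : Type*}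
    [Fintype ι] [DecidableEq ι] [IsProbabilityMeasure μ] (hd : IsLeftInvariantMetric d)
    (hN : A.IsAdmissible d N) (hmix : A.ExpMixingAllOrders d N)
    (f : A.toSubmodule) {g : X → ℝ} (hg : (f : Lp ℝ ∞ μ) =ᵐ[μ] g) {B : ℝ} (hB : 1 ≤ B)
    (hgB : ∀ x, |g x| ≤ B) (a : ι) (K : ℝ) (hK : 0 ≤ K) :
    ∃ R C : ℝ, 0 ≤ R ∧ 0 ≤ C ∧ ∀ (L : ℝ) (h : ι → H), 0 ≤ L →
      (∀ i, d (h a) (h i) ≤ R * L) ∨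
      |rootedCumulant (mixedMoment μ g h) a (Finset.univ.erase a)| ≤ C * Real.exp (-K * L) := by
  obtain ⟨δ, b, C₀, hδ, hb, hC₀, hclus⟩ :=
    hmix.exists_abs_mixedMoment_sub_prod_le (ι := ι) hd hN f hg
  obtain ⟨C₁, hC₁, hsplit⟩ := exists_abs_rootedCumulant_le_of_split (ι := ι)
    (B ^ Fintype.card ι) (one_le_pow₀ hB) (Fintype.card ι)
  -- At scale `j` the diameter is `r j * L` and the gap `(b * r j + K) / δ * L`, chosen so that `b *
  -- diameter - δ * gap = -K * L`. The start `r 0 = 0` fits the labelling by singletons.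
  let r : ℕ → ℝ := fun j => Nat.rec 0 (fun _ x => 2 * x + (b * x + K) / δ) j
  have hr_succ : ∀ j, r (j + 1) = 2 * r j + (b * r j + K) / δ := fun _ => rfl
  have hr0 : ∀ j, 0 ≤ r j := by
    intro j
    induction j with
    | zero => exact le_rfl
    | succ j ih => rw [hr_succ]; positivity
  have hrmono : Monotone r := monotone_nat_of_le_succ fun j => by
    rw [hr_succ]
    have : 0 ≤ (b * r j + K) / δ := by have := hr0 j; positivity
    linarith [hr0 j]
  refine ⟨r (Fintype.card ι), C₁ * ((1 + B ^ Fintype.card ι) * C₀), hr0 _, by positivity,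
    fun L h hL => ?_⟩
  have := exists_separated_clusters (fun i j => d (h i) (h j)) (fun i j => hd.symm _ _)
    (fun i j k => hd.triangle _ _ _) (fun j => r j * L) (fun j => (b * r j + K) / δ * L)
    (fun i j hij => mul_le_mul_of_nonneg_right (hrmono hij) hL)
    (fun j => by rw [hr_succ]; apply le_of_eq; ring) (Fintype.card ι) 0 id
    ((Finset.card_le_univ _).trans (Nat.le_succ _))
    (fun i i' hii => by rw [show i = i' from hii, hd.self]; simp [r])
  rcases this with h1 | ⟨j, -, lab, ⟨i, i', hne⟩, hdiam, hsep⟩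
  · left
    intro i
    simpa using h1 a i
  · right
    have hrj := hr0 j
    have hε := fun I => hclus h I lab _ _ (by positivity : 0 ≤ r j * L)
      (by positivity : 0 ≤ (b * r j + K) / δ * L) hdiam hsep
    have hexp : b * (r j * L) - δ * ((b * r j + K) / δ * L) = -K * L := by field_simp; ring
    rw [hexp] at hε
    have hbd := abs_mixedMoment_le (ι := ι) μ hB hgB h
    have := hsplit (mixedMoment μ g h) a (Finset.univ.erase a)
      (Finset.univ.filter (fun i => lab i = lab a)) _ (mixedMoment_empty μ g h) hbd (by simp)
      (abs_sub_mul_le_of_clusters (mixedMoment_empty μ g h) hbd hε (q₀ := lab a) (by simp))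
      (Finset.card_le_univ _) ?_
    · refine this.trans (le_of_eq ?_)
      ring
    -- If the cluster of `a` contained all other indices, there would be only one label.
    · intro hsub
      have hall : ∀ i, lab i = lab a := fun i => by
        by_cases hi : i = a
        · rw [hi]
        · simpa using hsub (Finset.mem_erase.2 ⟨hi, Finset.mem_univ i⟩)
      exact hne ((hall i).trans (hall i').symm)

end Mixing

/-! ### Cumulants of averages as averaged joint cumulants. -/

lemma momentCumulant_mul_pow (c : ℝ) (M : ℕ → ℝ) (n : ℕ) :
    momentCumulant (fun k => c ^ k * M k) n = c ^ (n + 1) * momentCumulant M n := by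
  induction n using Nat.strong_induction_on with
  | _ n ih =>
    rw [momentCumulant, momentCumulant, mul_sub, Finset.mul_sum]
    congr 1
    refine Finset.sum_congr rfl fun k _ => ?_
    rw [ih k k.2]
    have : c ^ (n + 1) = c ^ ((k : ℕ) + 1) * c ^ (n - k) := by
      rw [← pow_add]; congr 1; have := k.2; omega
    rw [this]; ring

/-- Functions depending on disjoint sets of coordinates are independent under a product measure. -/
lemma integral_mul_pi_of_dependsOn_disjoint {ι E : Type*} [Fintype ι] [DecidableEq ι]
    [MeasurableSpace E] [Nonempty E] (p : Measure E) [IsProbabilityMeasure p]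
    {F G : (ι → E) → ℝ} (hF : Measurable F) (hG : Measurable G) {S T : Finset ι}
    (hST : Disjoint S T) (hFS : DependsOn F S) (hGT : DependsOn G T) :
    ∫ h, F h * G h ∂(Measure.pi fun _ => p)
      = (∫ h, F h ∂(Measure.pi fun _ => p)) * ∫ h, G h ∂(Measure.pi fun _ => p) := by
  obtain ⟨x₀⟩ := ‹Nonempty E›
  -- Padding with `x₀` exhibits `F` and `G` as measurable functions of the coordinates in `S` and
  -- `T`, which are independent families.
  let ext (S : Finset ι) (u : S → E) (i : ι) : E := if hi : i ∈ S then u ⟨i, hi⟩ else x₀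
  have hext : ∀ S, Measurable (ext S) := fun S => by
    refine measurable_pi_lambda _ fun i => ?_
    by_cases hi : i ∈ S
    · simpa only [ext, hi, dif_pos] using measurable_pi_apply _
    · simpa only [ext, hi, dif_neg, not_false_eq_true] using measurable_const
  have hind : iIndepFun (fun (i : ι) (h : ι → E) => h i) (Measure.pi fun _ => p) :=
    iIndepFun_pi (X := fun _ x => x) fun _ => aemeasurable_id
  have h1 := hind.indepFun_finset S T hST fun i => measurable_pi_apply i
  have h2 := h1.comp (hF.comp (hext S)) (hG.comp (hext T))
  have eF : (F ∘ ext S) ∘ (fun (h : ι → E) (i : S) => h i) = F := by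
    funext h
    refine hFS fun i hi => ?_
    simp [ext, Finset.mem_coe.1 hi]
  have eG : (G ∘ ext T) ∘ (fun (h : ι → E) (i : T) => h i) = G := by
    funext h
    refine hGT fun i hi => ?_
    simp [ext, Finset.mem_coe.1 hi]
  rw [eF, eG] at h2
  exact h2.integral_fun_mul_eq_mul_integral hF.aestronglyMeasurable hG.aestronglyMeasurable

section IntegratedCumulant

variable {H X ι : Type*} [Group H] [MeasurableSpace H] [MeasurableInv H] [MeasurableSpace X]
  [MulAction H X] [MeasurableSMul₂ H X] {g : X → ℝ} (μ : Measure X)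

lemma measurable_prod_smul (hg : Measurable g) (I : Finset ι) :
    Measurable fun z : (ι → H) × X => ∏ i ∈ I, g ((z.1 i)⁻¹ • z.2) := by
  refine Finset.measurable_prod _ fun i _ => hg.comp ?_
  exact (((measurable_pi_apply i).comp measurable_fst).inv).smul measurable_snd

lemma measurable_mixedMoment [IsProbabilityMeasure μ] (hg : Measurable g) (I : Finset ι) :
    Measurable fun h : ι → H => mixedMoment μ g h I :=
  (measurable_prod_smul hg I).stronglyMeasurable.integral_prod_right'.measurable

lemma measurable_rootedCumulant [DecidableEq ι] [IsProbabilityMeasure μ] (hg : Measurable g) (a : ι)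
    (S : Finset ι) : Measurable fun h : ι → H => rootedCumulant (mixedMoment μ g h) a S := by
  induction S using Finset.strongInduction with
  | H S ih =>
    simp_rw [fun h : ι → H => rootedCumulant_eq (mixedMoment μ g h) a S]
    refine (measurable_mixedMoment μ hg _).sub (Finset.measurable_sum _ fun J hJ => ?_)
    exact (ih J (Finset.mem_ssubsets.1 hJ)).mul (measurable_mixedMoment μ hg _)

variable [Fintype ι]

/-- After Fubini, the integral over configurations at fixed `x` is a product of identical one-point
integrals, with factors 1 off `I`. -/
lemma integral_mixedMoment [IsProbabilityMeasure μ] (p : Measure H) [IsProbabilityMeasure p]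
    (hg : Measurable g) {B : ℝ} (hB : 1 ≤ B) (hgB : ∀ x, |g x| ≤ B) (I : Finset ι) :
    ∫ h, mixedMoment μ g h I ∂(Measure.pi fun _ => p)
      = ∫ x, (∫ h, g (h⁻¹ • x) ∂p) ^ I.card ∂μ := by
  classical
  simp only [mixedMoment]
  rw [integral_integral_swap]
  · refine integral_congr_ae (ae_of_all _ fun x => ?_)
    have h1 : ∀ h : ι → H, ∏ i ∈ I, g ((h i)⁻¹ • x)
        = ∏ i, (fun y : H => if i ∈ I then g (y⁻¹ • x) else 1) (h i) := fun h => by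
      simp [Finset.prod_ite_mem]
    simp only [h1]
    rw [integral_fintype_prod_eq_prod (fun i (y : H) => if i ∈ I then g (y⁻¹ • x) else 1)]
    have h2 : ∀ i, ∫ y : H, (if i ∈ I then g (y⁻¹ • x) else 1) ∂p
        = if i ∈ I then ∫ y, g (y⁻¹ • x) ∂p else 1 := fun i => by
      split_ifs <;> simp
    simp only [h2, Finset.prod_ite_mem, Finset.univ_inter, Finset.prod_const]
  · refine Integrable.of_bound (C := B ^ Fintype.card ι)
      (measurable_prod_smul hg I).aestronglyMeasurable (ae_of_all _ fun z => ?_)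
    exact abs_prod_le_pow_card hB I fun i => hgB _

/-- The cumulants of an average are the averages of the joint cumulants. -/
lemma integral_rootedCumulant [DecidableEq ι] [IsProbabilityMeasure μ] (p : Measure H) [IsProbabilityMeasure p]
    (hg : Measurable g) {B : ℝ} (hB : 1 ≤ B) (hgB : ∀ x, |g x| ≤ B) (a : ι) (S : Finset ι)
    (ha : a ∉ S) :
    ∫ h, rootedCumulant (mixedMoment μ g h) a S ∂(Measure.pi fun _ => p)
      = momentCumulant (fun k => ∫ x, (∫ h, g (h⁻¹ • x) ∂p) ^ k ∂μ) S.card := by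
  set M : ℕ → ℝ := fun k => ∫ x, (∫ h, g (h⁻¹ • x) ∂p) ^ k ∂μ with hM
  have hbd : ∀ (h : ι → H) (I : Finset ι), |mixedMoment μ g h I| ≤ B ^ Fintype.card ι :=
    fun h I => abs_mixedMoment_le μ hB hgB h I
  induction S using Finset.strongInduction with
  | H S ih =>
    have hintm : ∀ I : Finset ι,
        Integrable (fun h : ι → H => mixedMoment μ g h I) (Measure.pi fun _ => p) := fun I =>
      Integrable.of_bound (measurable_mixedMoment μ hg I).aestronglyMeasurable _
        (ae_of_all _ fun h => hbd h I)
    have hintc : ∀ J I : Finset ι, Integrable (fun h : ι → H =>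
        rootedCumulant (mixedMoment μ g h) a J * mixedMoment μ g h I)
        (Measure.pi fun _ => p) := fun J I => by
      obtain ⟨C, hC, hCb⟩ := exists_abs_rootedCumulant_le (ι := ι) (B ^ Fintype.card ι)
        (by positivity) (Fintype.card ι)
      refine Integrable.of_bound (C := C * B ^ Fintype.card ι) ((measurable_rootedCumulant μ hg a J).mul
        (measurable_mixedMoment μ hg I)).aestronglyMeasurable (ae_of_all _ fun h => ?_)
      rw [norm_mul]
      exact mul_le_mul (hCb _ a J (hbd h) (Finset.card_le_univ _)) (hbd h I) (norm_nonneg _) hC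
    simp_rw [fun h : ι → H => rootedCumulant_eq (mixedMoment μ g h) a S]
    rw [integral_sub (hintm _) (integrable_finsetSum _ fun J _ => hintc J _),
      integral_finsetSum _ fun J _ => hintc J _, integral_mixedMoment μ p hg hB hgB,
      Finset.card_insert_of_notMem ha, momentCumulant]
    congr 1
    -- The two factors depend on the disjoint coordinate sets `insert a J` and `S \ J`, so the
    -- integral factors.
    have h1 : ∀ J ∈ S.ssubsets, ∫ h, rootedCumulant (mixedMoment μ g h) a J
        * mixedMoment μ g h (S \ J) ∂(Measure.pi fun _ => p)
        = momentCumulant M J.card * M (S.card - J.card) := fun J hJ => by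
      have hJ := Finset.mem_ssubsets.1 hJ
      rw [integral_mul_pi_of_dependsOn_disjoint p (measurable_rootedCumulant μ hg a J)
        (measurable_mixedMoment μ hg (S \ J)) (S := insert a J) (T := S \ J) ?_
        (dependsOn_rootedCumulant μ g a J) (dependsOn_mixedMoment μ g _),
        ih J hJ fun h => ha (hJ.subset h), integral_mixedMoment μ p hg hB hgB,
        Finset.card_sdiff_of_subset hJ.subset]
      rw [Finset.disjoint_insert_left]
      exact ⟨fun h => ha (Finset.mem_sdiff.1 h).1, Finset.disjoint_sdiff⟩
    rw [Finset.sum_congr rfl h1]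
    -- Grouping the `J` by cardinality produces the binomial coefficients; the term `J = S` cancels.
    have h2 := Finset.sum_powerset_apply_card
      (fun k => momentCumulant M k * M (S.card - k)) (x := S)
    rw [Finset.sum_range_succ, ← Finset.add_sum_erase _ _ (Finset.mem_powerset_self S),
      Nat.choose_self, one_smul, add_comm, add_right_cancel_iff] at h2
    rw [Finset.ssubsets, h2, Finset.sum_range]
    simp

end IntegratedCumulant

/-! ### Bounds on the cumulants of `ν * g`. -/

/-- The product measure of the configurations contained in a ball around their first point. -/
lemma pi_setOf_mem_metricBall {H : Type*} [Group H] [MeasurableSpace H] [MeasurableInv H]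
    [MeasurableMul₂ H] {d : H → H → ℝ} (hd : IsLeftInvariantMetric d) (p : Measure H)
    [SigmaFinite p] (n : ℕ) (ρ : ℝ) :
    MeasurableSet {h : Fin (n + 1) → H | ∀ i : Fin n, h i.succ ∈ metricBall d (h 0) ρ} ∧
    (Measure.pi fun _ : Fin (n + 1) => p)
        {h | ∀ i : Fin n, h i.succ ∈ metricBall d (h 0) ρ}
      = ∫⁻ x, p (metricBall d x ρ) ^ n ∂p := by
  -- Left invariance reduces joint measurability in centre and point to measurability of one ball.
  have hball : ∀ x y, y ∈ metricBall d x ρ ↔ x⁻¹ * y ∈ metricBall d 1 ρ := fun x y => by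
    simp only [metricBall, Set.mem_ofPred_eq]
    rw [← hd.left_invariant x 1]
    simp
  have hmb : MeasurableSet (metricBall d 1 ρ) := hd.measurableSet_ball 1 ρ
  let E : Set (H × (Fin n → H)) := {z | ∀ i, z.2 i ∈ metricBall d z.1 ρ}
  have hE : MeasurableSet E := by
    have : E = ⋂ i, (fun z : H × (Fin n → H) => z.1⁻¹ * z.2 i) ⁻¹' metricBall d 1 ρ := by
      ext z
      simp [E, hball z.1]
    rw [this]
    refine MeasurableSet.iInter fun i => hmb.preimage ?_
    exact measurable_fst.inv.mul ((measurable_pi_apply i).comp measurable_snd)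
  have hmp := measurePreserving_piFinSuccAbove (fun _ : Fin (n + 1) => p) 0
  have hset : {h : Fin (n + 1) → H | ∀ i : Fin n, h i.succ ∈ metricBall d (h 0) ρ}
      = MeasurableEquiv.piFinSuccAbove (fun _ : Fin (n + 1) => H) 0 ⁻¹' E := rfl
  refine ⟨hset ▸ hE.preimage (MeasurableEquiv.measurable _), ?_⟩
  rw [hset, hmp.measure_preimage hE.nullMeasurableSet, Measure.prod_apply hE]
  refine lintegral_congr fun x => ?_
  have : Prod.mk x ⁻¹' E = Set.univ.pi fun _ : Fin n => metricBall d x ρ := by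
    ext z; simp [E]
  rw [this, Measure.pi_pi]
  simp

/-- A cumulant of order at least two of `ν * g` is controlled by the mass of the pairs of close
points, up to an error which is small when `ν` has large mass. -/
lemma InvariantSubalgebra.ExpMixingAllOrders.exists_abs_momentCumulant_le {H X : Type*} [Group H]
    [MeasurableSpace H] [MeasurableInv H] [MeasurableMul₂ H] [MeasurableSpace X] [MulAction H X]
    [MeasurableSMul₂ H X] {μ : Measure X} [SMulInvariantMeasure H X μ] [IsProbabilityMeasure μ]
    {A : InvariantSubalgebra H μ} {d : H → H → ℝ} {N : ℕ → Seminorm ℝ A.toSubmodule}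
    (hd : IsLeftInvariantMetric d)
    (hN : A.IsAdmissible d N) (hmix : A.ExpMixingAllOrders d N)
    (f : A.toSubmodule) {g : X → ℝ} (hg : (f : Lp ℝ ∞ μ) =ᵐ[μ] g) (hgm : Measurable g)
    {B : ℝ} (hB : 1 ≤ B) (hgB : ∀ x, |g x| ≤ B) (n : ℕ) :
    ∃ R C : ℝ, 0 < R ∧ 0 ≤ C ∧ ∀ ν : Measure H, IsFiniteMeasure ν → 1 < ν.real Set.univ →
      |momentCumulant (fun k => ∫ x, (∫ h, g (h⁻¹ • x) ∂ν) ^ k ∂μ) n|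
        ≤ C * ((∫⁻ h, ν (metricBall d h (R * Real.log (ν.real Set.univ))) ^ n ∂ν).toReal
          + (ν.real Set.univ)⁻¹) := by
  -- With `K = n + 2` and `L = log m`, the error beats the prefactor `m ^ (n + 1)` by one power,
  -- leaving `m⁻¹`.
  obtain ⟨R, C, hR, hC, hdich⟩ := hmix.exists_dist_le_or_abs_rootedCumulant_le
    (ι := Fin (n + 1)) hd hN f hg hB hgB 0 (n + 2) (by positivity)
  obtain ⟨C', hC', hbdd⟩ := exists_abs_rootedCumulant_le (ι := Fin (n + 1))
    (B ^ Fintype.card (Fin (n + 1))) (by positivity) (n + 1)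
  -- Enlarging `R` to `R + 1` gives a positive radius and the strict inequality required by open
  -- balls.
  refine ⟨R + 1, C' + C, by positivity, by positivity, fun ν hν hm => ?_⟩
  set m : ℝ := ν.real Set.univ with hmdef
  have hm0 : 0 < m := by linarith
  have hlog : 0 < Real.log m := Real.log_pos hm
  set ρ : ℝ := (R + 1) * Real.log m with hρ
  have hc0 : ν Set.univ ≠ 0 := fun h => by
    rw [hmdef, Measure.real, h] at hm0; simp at hm0
  have hctop : ν Set.univ ≠ ⊤ := measure_ne_top ν _
  set c : ℝ≥0∞ := ν Set.univ with hc
  set p : Measure H := c⁻¹ • ν with hp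
  have hpp : IsProbabilityMeasure p := ⟨by
    rw [hp, Measure.smul_apply, smul_eq_mul, ← hc, ENNReal.inv_mul_cancel hc0 hctop]⟩
  have hcm : c.toReal = m := rfl
  have hX : ∀ x, ∫ h, g (h⁻¹ • x) ∂ν = m * ∫ h, g (h⁻¹ • x) ∂p := fun x => by
    rw [hp, integral_smul_measure, ENNReal.toReal_inv, hcm, smul_eq_mul, mul_inv_cancel_left₀ hm0.ne']
  have e1 : momentCumulant (fun k => ∫ x, (∫ h, g (h⁻¹ • x) ∂ν) ^ k ∂μ) n = m ^ (n + 1) *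
      ∫ h, rootedCumulant (mixedMoment μ g h) 0 (Finset.univ.erase (0 : Fin (n + 1)))
        ∂(Measure.pi fun _ => p) := by
    rw [integral_rootedCumulant μ p hgm hB hgB _ _ (Finset.notMem_erase _ _),
      Finset.card_erase_of_mem (Finset.mem_univ _), Finset.card_univ, Fintype.card_fin,
      Nat.add_sub_cancel, ← momentCumulant_mul_pow]
    simp only [hX, mul_pow, integral_const_mul]
  obtain ⟨hΔm, hΔ⟩ := pi_setOf_mem_metricBall hd p n ρ
  set Δ : Set (Fin (n + 1) → H) := {h | ∀ i : Fin n, h i.succ ∈ metricBall d (h 0) ρ} with hΔdef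
  set P : Measure (Fin (n + 1) → H) := Measure.pi fun _ => p with hP
  have hΔ' : m ^ (n + 1) * P.real Δ = (∫⁻ h, ν (metricBall d h ρ) ^ n ∂ν).toReal := by
    have : c ^ (n + 1) * P Δ = ∫⁻ h, ν (metricBall d h ρ) ^ n ∂ν := by
      have hcc : c ^ (n + 1) * (c⁻¹ * (c⁻¹) ^ n) = 1 := by
        rw [← pow_succ', ← mul_pow, ENNReal.mul_inv_cancel hc0 hctop, one_pow]
      rw [hΔ, hp, lintegral_smul_measure]
      simp only [Measure.smul_apply, smul_eq_mul, mul_pow]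
      rw [lintegral_const_mul' _ _ (ENNReal.pow_ne_top (ENNReal.inv_ne_top.2 hc0)), ← mul_assoc,
        ← mul_assoc, mul_assoc (c ^ (n + 1)), hcc, one_mul]
    rw [← this, ENNReal.toReal_mul, ENNReal.toReal_pow, hcm]
    rfl
  have hpt : ∀ h : Fin (n + 1) → H,
      ‖rootedCumulant (mixedMoment μ g h) 0 (Finset.univ.erase (0 : Fin (n + 1)))‖
        ≤ Δ.indicator (fun _ => C') h + C * Real.exp (-(n + 2) * Real.log m) := by
    intro h
    by_cases hh : h ∈ Δ
    · rw [Set.indicator_of_mem hh]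
      have h1 := hbdd (mixedMoment μ g h) 0 (Finset.univ.erase (0 : Fin (n + 1)))
        (abs_mixedMoment_le μ hB hgB h) ((Finset.card_le_univ _).trans (by simp))
      have : 0 ≤ C * Real.exp (-(n + 2) * Real.log m) := by positivity
      rw [Real.norm_eq_abs]
      linarith
    · rw [Set.indicator_of_notMem hh, zero_add]
      rcases hdich (Real.log m) h hlog.le with h1 | h1
      · refine absurd (fun i => ?_) hh
        change d (h 0) (h i.succ) < ρ
        have := h1 i.succ
        rw [hρ]
        linarith
      · exact h1
  have hexp : m ^ (n + 1) * Real.exp (-(n + 2) * Real.log m) = m⁻¹ := by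
    have : Real.exp (-(n + 2) * Real.log m) = (m ^ (n + 2))⁻¹ := by
      rw [neg_mul, Real.exp_neg, ← Real.exp_log hm0, ← Real.exp_nat_mul, Real.log_exp]
      push_cast; rfl
    rw [this, pow_succ m (n + 1)]
    field_simp
  have hintegral : |∫ h, rootedCumulant (mixedMoment μ g h) 0
      (Finset.univ.erase (0 : Fin (n + 1))) ∂P|
      ≤ C' * P.real Δ + C * Real.exp (-(n + 2) * Real.log m) := by
    have hi : Integrable (Δ.indicator fun _ => C') P := (integrable_const C').indicator hΔm
    refine (norm_integral_le_of_norm_le (hi.add (integrable_const _)) (ae_of_all _ hpt)).trans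
      (le_of_eq ?_)
    simp only [Pi.add_apply]
    rw [integral_add hi (integrable_const _), integral_indicator hΔm]
    simp [mul_comm]
  rw [e1, abs_mul, abs_of_pos (by positivity : 0 < m ^ (n + 1))]
  calc _ ≤ m ^ (n + 1) * (C' * P.real Δ + C * Real.exp (-(n + 2) * Real.log m)) := by gcongr
    _ = C' * (m ^ (n + 1) * P.real Δ) + C * (m ^ (n + 1) * Real.exp (-(n + 2) * Real.log m)) := by
      ring
    _ = C' * (∫⁻ h, ν (metricBall d h ρ) ^ n ∂ν).toReal + C * m⁻¹ := by rw [hΔ', hexp]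
    _ ≤ (C' + C) * ((∫⁻ h, ν (metricBall d h ρ) ^ n ∂ν).toReal + m⁻¹) := by
      have h1 : 0 ≤ (∫⁻ h, ν (metricBall d h ρ) ^ n ∂ν).toReal := ENNReal.toReal_nonneg
      have h2 : 0 ≤ m⁻¹ := by positivity
      nlinarith [mul_nonneg hC h1, mul_nonneg hC' h2]

/-! ### Representatives and the conclusion. -/

/-- Clipping at `max 1 ‖f‖` changes `f` only on a null set and gives a bound at every point, hence
along whole orbits. -/
lemma exists_bounded_measurable_representative {X : Type*} [MeasurableSpace X] {μ : Measure X}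
    (f : Lp ℝ ∞ μ) :
    ∃ (g : X → ℝ) (B : ℝ), f =ᵐ[μ] g ∧ Measurable g ∧ 1 ≤ B ∧ ∀ x, |g x| ≤ B := by
  have hB : (0 : ℝ) ≤ max 1 ‖f‖ := le_max_of_le_left zero_le_one
  refine ⟨fun x => max (-max 1 ‖f‖) (min (max 1 ‖f‖) (f x)), max 1 ‖f‖, ?_, ?_, le_max_left _ _,
    fun x => abs_le.2 ⟨le_max_left _ _, max_le (by linarith) (min_le_left _ _)⟩⟩
  · have h := ae_le_eLpNormEssSup (f := f) (μ := μ)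
    filter_upwards [h] with x hx
    have hx' : |f x| ≤ max 1 ‖f‖ := by
      refine le_max_of_le_right ?_
      rw [Lp.norm_def, eLpNorm_exponent_top, ← Real.norm_eq_abs, ← toReal_enorm]
      refine ENNReal.toReal_mono ?_ hx
      rw [← eLpNorm_exponent_top]
      exact Lp.eLpNorm_ne_top f
    rw [min_eq_right (abs_le.1 hx').2, max_eq_right (abs_le.1 hx').1]
  · exact measurable_const.max (measurable_const.min (Lp.stronglyMeasurable f).measurable)

/-- Each translate respects null sets, and Fubini exchanges "for every `h`, almost every `x`" for
"for almost every `x`, almost every `h`". -/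
lemma averageBy_ae_eq {H X : Type*} [Group H] [MeasurableSpace H] [MeasurableInv H]
    [MeasurableSpace X] [MulAction H X] [MeasurableSMul₂ H X] {μ : Measure X} [SFinite μ]
    [SMulInvariantMeasure H X μ] (ν : Measure H) [SFinite ν] (f : Lp ℝ ∞ μ) {g : X → ℝ}
    (hg : f =ᵐ[μ] g) (hgm : Measurable g) :
    averageBy ν f =ᵐ[μ] fun x => ∫ h, g (h⁻¹ • x) ∂ν := by
  have hfm := (Lp.stronglyMeasurable f).measurable
  have hact : Measurable fun z : H × X => z.1⁻¹ • z.2 := measurable_fst.inv.smul measurable_snd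
  have h1 : ∀ᵐ h ∂ν, ∀ᵐ x ∂μ, f (h⁻¹ • x) = g (h⁻¹ • x) := ae_of_all _ fun h =>
    (measurePreserving_smul h⁻¹ μ).quasiMeasurePreserving.ae_eq_comp hg
  have h2 := (Measure.ae_ae_comm (p := fun (h : H) (x : X) => f (h⁻¹ • x) = g (h⁻¹ • x))
    (measurableSet_eq_fun (hfm.comp hact) (hgm.comp hact))).1 h1
  filter_upwards [h2] with x hx
  exact integral_congr_ae hx

theorem theorem1p4 {H X : Type*}
    [Group H] [TopologicalSpace H] [IsTopologicalGroup H] [LocallyCompactSpace H]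
    [SecondCountableTopology H] [MeasurableSpace H] [BorelSpace H]
    (d : H → H → ℝ) (hd : IsLeftInvariantMetric d)
    [MeasurableSpace X] (μ : Measure X) [IsProbabilityMeasure μ]
    [MulAction H X] [MeasurableSMul₂ H X] [SMulInvariantMeasure H X μ]
    (A : InvariantSubalgebra H μ) (N : ℕ → Seminorm ℝ A.toSubmodule)
    (hN : A.IsAdmissible d N) (hmix : A.ExpMixingAllOrders d N)
    (ν : ℕ → Measure H) [∀ T, IsFiniteMeasure (ν T)]
    (hν_mass : Tendsto (fun T => (ν T).real Set.univ) atTop atTop)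
    (hν : ∀ r : ℕ, 3 ≤ r → ∀ c : ℝ, 0 < c →
      Tendsto
        (fun T => ∫⁻ h, (ν T (metricBall d h (c * Real.log ((ν T).real Set.univ)))) ^ (r - 1) ∂(ν T))
        atTop (𝓝 0))
    (f : Lp ℝ ∞ μ) (hf : f ∈ A.toSubmodule) (hf_mean : ∫ x, f x ∂μ = 0)
    (σ : ℝ≥0)
    (hσ : Tendsto (fun T => (eLpNorm (averageBy (ν T) f) 2 μ).toReal ^ 2) atTop
      (𝓝 ((σ : ℝ) ^ 2))) :
    TendstoInDistribution (fun T => averageBy (ν T) f) atTop (id : ℝ → ℝ) (fun _ => μ)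
      (gaussianReal 0 (σ ^ 2)) := by
  obtain ⟨g, B, hfg, hgm, hB, hgB⟩ := exists_bounded_measurable_representative f
  have hact : Measurable fun z : X × H => z.2⁻¹ • z.1 := measurable_snd.inv.smul measurable_fst
  have hYm : ∀ T, Measurable fun x => ∫ h, g (h⁻¹ • x) ∂(ν T) := fun T =>
    (hgm.comp hact).stronglyMeasurable.integral_prod_right'.measurable
  have hYb : ∀ T x, |∫ h, g (h⁻¹ • x) ∂(ν T)| ≤ B * (ν T).real Set.univ := fun T x =>
    norm_integral_le_of_norm_le_const (f := fun h => g (h⁻¹ • x)) (ae_of_all _ fun h => hgB _)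
  have hYint : ∀ T k, Integrable (fun x => (∫ h, g (h⁻¹ • x) ∂(ν T)) ^ k) μ := fun T k => by
    refine Integrable.of_bound (C := (B * (ν T).real Set.univ) ^ k)
      ((hYm T).pow_const k).aestronglyMeasurable (ae_of_all _ fun x => ?_)
    rw [norm_pow]
    exact pow_le_pow_left₀ (norm_nonneg _) (hYb T x) k
  have hae : ∀ T, averageBy (ν T) f =ᵐ[μ] fun x => ∫ h, g (h⁻¹ • x) ∂(ν T) := fun T =>
    averageBy_ae_eq (ν T) f hfg hgm
  have hM1 : ∀ T, ∫ x, ∫ h, g (h⁻¹ • x) ∂(ν T) ∂μ = 0 := fun T => by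
    rw [integral_integral_swap]
    · have : ∀ h : H, ∫ x, g (h⁻¹ • x) ∂μ = 0 := fun h => by
        rw [integral_smul_eq_self (fun x => g x), ← integral_congr_ae hfg, hf_mean]
      simp [this]
    · exact Integrable.of_bound (hgm.comp hact).aestronglyMeasurable B
        (ae_of_all _ fun z => hgB _)
  have hM2 : ∀ T, ∫ x, (∫ h, g (h⁻¹ • x) ∂(ν T)) ^ 2 ∂μ
      = (eLpNorm (averageBy (ν T) f) 2 μ).toReal ^ 2 := fun T => by
    have hmem : MemLp (fun x => ∫ h, g (h⁻¹ • x) ∂(ν T)) 2 μ :=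
      MemLp.of_bound (hYm T).aestronglyMeasurable _ (ae_of_all _ (hYb T))
    have h0 : 0 ≤ ∫ x, (∫ h, g (h⁻¹ • x) ∂(ν T)) ^ 2 ∂μ := integral_nonneg fun x => sq_nonneg _
    rw [eLpNorm_congr_ae (hae T), hmem.eLpNorm_eq_integral_rpow_norm two_ne_zero ENNReal.ofNat_ne_top]
    simp only [ENNReal.toReal_ofNat, Real.rpow_ofNat, Real.norm_eq_abs, sq_abs]
    rw [ENNReal.toReal_ofReal (by positivity), ← Real.rpow_natCast, ← Real.rpow_mul h0]
    norm_num
  refine TendstoInDistribution.congr (fun T => (hae T).symm) (EventuallyEq.refl _ _)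
    (tendstoInDistribution_gaussianReal_of_tendsto_moment (fun T => (hYm T).aemeasurable) hYint
      fun k => tendsto_moment_of_tendsto_momentCumulant (M := fun T k =>
        ∫ x, (∫ h, g (h⁻¹ • x) ∂(ν T)) ^ k ∂μ) (fun T => by simp) ?_ ?_ ?_ k)
  · simp only [momentCumulant_zero, pow_one, hM1, tendsto_const_nhds_iff]
  · simpa [momentCumulant_one, hM1, hM2] using hσ
  · intro n hn
    obtain ⟨R, C, hR, hC, hbound⟩ := hmix.exists_abs_momentCumulant_le hd hN ⟨f, hf⟩ hfg hgm hB hgB n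
    -- Index `n` is the cumulant of order `n + 1`, so the hypothesis applies with `r = n + 1` and `c
    -- = R`.
    have h1 : Tendsto (fun T =>
        (∫⁻ h, (ν T (metricBall d h (R * Real.log ((ν T).real Set.univ)))) ^ n ∂(ν T)).toReal)
        atTop (𝓝 0) :=
      (ENNReal.tendsto_toReal ENNReal.zero_ne_top).comp (hν (n + 1) (by omega) R hR)
    have h2 : Tendsto (fun T => ((ν T).real Set.univ)⁻¹) atTop (𝓝 0) := hν_mass.inv_tendsto_atTop
    refine squeeze_zero_norm' ?_ (by simpa using (h1.add h2).const_mul C)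
    filter_upwards [hν_mass.eventually_gt_atTop 1] with T hT
    exact hbound (ν T) inferInstance hT
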